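/- Let $\mathbf k$ be a field of characteristic $p>0$, let $d\ge 0$, and let $A=\mathbf k[x]/(x^p)$, graded by $\deg x=2$. Tensor products are over $\mathbf k$. Let $\mathcal V$ be the category of finite dimensional $\mathbf k$-spaces, and let $\mathcal V_A$ be the category whose objects are the graded $A$-modules $V\otimes A$ ($V\in\mathcal V$ in degree $0$), with $\mathrm{Hom}_{\mathcal V_A}(V\otimes A,W\otimes A)=\mathrm{Hom}_A(V\otimes A,W\otimes A)\cong \mathrm{Hom}(V,W)\otimes A$, graded by the degree of maps; $\mathcal V$ is regarded as graded in degree $0$. For a graded $\mathbf k$-linear category $\mathcal C$ let $\Gamma^d\mathcal C$ be the graded $\mathbf k$-linear category with the same objects and $\mathrm{Hom}_{\Gamma^d\mathcal C}(X,Y)=\Gamma^d(\mathrm{Hom}_{\mathcal C}(X,Y))$, where $\Gamma^d(M)=(M^{\otimes d})^{\Sigma_d}$. Let $\mathcal V^{f+}$ be the category of $\mathbb Z$-graded, bounded below $\mathbf k$-spaces that are finite dimensional in each degree, with graded Hom spaces (finite sums of homogeneous linear maps). Let $\mathcal P_d^{f+}$ (resp. $\mathcal P_d^{af}$) be the category of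 $\mathbf k$-linear degree-preserving functors $\Gamma^d\mathcal V\to\mathcal V^{f+}$ (resp. $\Gamma^d\mathcal V_A\to\mathcal V^{f+}$), with all natural transformations as morphisms; a natural transformation is homogeneous of degree $n$ if all its components are. The forgetful functor $z:\mathcal V_A\to\mathcal V$ (the underlying $\mathbf k$-space of $V\otimes A$) and the induction functor $t:\mathcal V\to\mathcal V_A$, $V\mapsto V\otimes A$, induce functors $z:\Gamma^d\mathcal V_A\to\Gamma^d\mathcal V$ and $t:\Gamma^d\mathcal V\to\Gamma^d\mathcal V_A$. Let $t^*:\mathcal P_d^{af}\to\mathcal P_d^{f+}$ be $G\mapsto G\circ t$, and let $z^*:\mathcal P_d^{f+}\to\mathcal P_d^{af}$ be $F\mapsto F\circ z$ with the following grading: for $F=\bigoplus_s F^s$ and $\gamma=(\gamma_0,\dots,\gamma_{p-1})$ with $\sum_j\gamma_j=d$, let $F^s(V\otimes A)_\gamma$ be the part of $F^s(\bigoplus_j V\otimes x^j)$ of degree $\gamma_j$ in $V\otimes x^j$ for every $j$; it is placed in degree $s+\sum_j 2j\,\gamma_j$. For $U\in\mathcal V$ let $\Gamma^{d,U}=\mathrm{Hom}_{\Gamma^d\mathcal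 V}(U,-)\in\mathcal P_d^{f+}$ and $h^{U\otimes A}=\mathrm{Hom}_{\Gamma^d\mathcal V_A}(U\otimes A,-)\in\mathcal P_d^{af}$ be the representable functors. 1. $z^*$ preserves representable objects: there are isomorphisms, homogeneous of degree $0$ and natural in $U\in\Gamma^d\mathcal V$, $$z^*(\Gamma^{d,U})\;\cong\; h^{U\otimes A}.$$ 2. The functor $t^*$ is right adjoint to $z^*$ as a functor of graded $\mathbf k$-linear categories: there are bijections $$\mathrm{Hom}_{\mathcal P_d^{af}}(z^*(F),G)\;\cong\;\mathrm{Hom}_{\mathcal P_d^{f+}}(F,t^*(G)),$$ natural in $F\in\mathcal P_d^{f+}$ and $G\in\mathcal P_d^{af}$, which are $\mathbf k$-linear and under which a morphism is homogeneous of degree $n$ if and only if its image is. -/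

import Mathlib

open CategoryTheory
open scoped TensorProduct

universe u v w

noncomputable section

namespace AffineSPF

section Gradings

variable {k : Type*} [Field k] {M M' : Type*} [AddCommGroup M] [Module k M]
  [AddCommGroup M'] [Module k M']

theorem isInternal_of_projections {ι : Type*} [DecidableEq ι] (N : ι → Submodule k M)
    (P : ι → M →ₗ[k] M) (h1 : ∀ n, ∀ x ∈ N n, P n x = x)
    (h2 : ∀ m n, m ≠ n → ∀ x ∈ N m, P n x = 0) (h3 : ⨆ n, N n = ⊤) :
    DirectSum.IsInternal N := by
  apply DirectSum.isInternal_submodule_of_iSupIndep_of_iSup_eq_top _ h3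
  intro n
  rw [Submodule.disjoint_def]
  intro x hx hx'
  have : (⨆ j, ⨆ (_ : j ≠ n), N j) ≤ LinearMap.ker (P n) :=
    iSup_le fun m => iSup_le fun hm x hx => h2 m n hm x hx
  rw [← h1 n x hx]
  exact this hx'

/-- The projection of `M = ⨁ N n` onto its `n`-th summand. -/
def gproj {N : ℤ → Submodule k M} (h : DirectSum.IsInternal N) (n : ℤ) : M →ₗ[k] M :=
  letI := h.chooseDecomposition
  (N n).subtype ∘ₗ DirectSum.component k ℤ (fun i => N i) n ∘ₗ
    (DirectSum.decomposeLinearEquiv N).toLinearMap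

variable {N : ℤ → Submodule k M} (h : DirectSum.IsInternal N)

theorem gproj_mem (n : ℤ) (x : M) : gproj h n x ∈ N n := by
  simp [gproj]

theorem gproj_same {n : ℤ} {x : M} (hx : x ∈ N n) : gproj h n x = x := by
  let := h.chooseDecomposition
  exact DirectSum.decompose_of_mem_same N hx

theorem gproj_ne {m n : ℤ} {x : M} (hx : x ∈ N m) (hmn : m ≠ n) : gproj h n x = 0 := by
  let := h.chooseDecomposition
  exact DirectSum.decompose_of_mem_ne N hx hmn

theorem exists_sum_gproj (x : M) : ∃ s : Finset ℤ, x = ∑ n ∈ s, gproj h n x := by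
  classical
  let := h.chooseDecomposition
  exact ⟨_, (DirectSum.sum_support_decompose N x).symm⟩

theorem gproj_comm {N' : ℤ → Submodule k M'} (h' : DirectSum.IsInternal N') (f : M →ₗ[k] M')
    (hf : ∀ n, ∀ x ∈ N n, f x ∈ N' n) (n : ℤ) (x : M) :
    gproj h' n (f x) = f (gproj h n x) := by
  have hx : x ∈ ⨆ n, N n := by rw [h.submodule_iSup_eq_top]; trivial
  induction hx using Submodule.iSup_induction' with
  | mem m x hx =>
    by_cases e : m = n
    · subst e; rw [gproj_same h hx, gproj_same h' (hf _ _ hx)]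
    · rw [gproj_ne h hx e, gproj_ne h' (hf _ _ hx) e, map_zero]
  | zero => simp
  | add x y _ _ h1 h2 => simp [h1, h2]

/-- A submodule stable under the projections inherits the grading. -/
theorem isInternal_comap (F : Submodule k M) (hF : ∀ n, ∀ x ∈ F, gproj h n x ∈ F) :
    DirectSum.IsInternal (fun n => (N n).comap F.subtype) := by
  refine isInternal_of_projections _ (fun n => (gproj h n).restrict (hF n)) ?_ ?_ ?_
  · intro n x hx
    ext
    exact gproj_same h hx
  · intro m n hmn x hx
    ext
    exact gproj_ne h hx hmn
  · rw [eq_top_iff]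
    intro x _
    obtain ⟨s, hs⟩ := exists_sum_gproj h x.1
    have : x = ∑ n ∈ s, (gproj h n).restrict (hF n) x := by
      ext
      rw [hs]
      simp [← hs]
    rw [this]
    refine Submodule.sum_mem _ fun n _ => Submodule.mem_iSup_of_mem n ?_
    exact gproj_mem h n x.1

end Gradings

section SymmetricTensors

variable (k : Type*) [Field k] (d : ℕ)
variable {X Y Z : Type*} [AddCommGroup X] [Module k X] [AddCommGroup Y] [Module k Y]
  [AddCommGroup Z] [Module k Z]

variable (X) in
/-- `Γ^d(X) = (X^{⊗ d})^{Σ_d}`, the space of symmetric `d`-tensors. -/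
def symTensors : Submodule k (⨂[k] _ : Fin d, X) where
  carrier := {t | ∀ σ : Equiv.Perm (Fin d), PiTensorProduct.reindex k (fun _ => X) σ t = t}
  add_mem' ha hb σ := by rw [map_add, ha σ, hb σ]
  zero_mem' σ := map_zero _
  smul_mem' c x hx σ := by rw [map_smul, hx σ]

theorem reindex_map (f : X →ₗ[k] Y) (σ : Equiv.Perm (Fin d)) (t : ⨂[k] _ : Fin d, X) :
    PiTensorProduct.reindex k (fun _ => Y) σ (PiTensorProduct.map (fun _ => f) t) =
      PiTensorProduct.map (fun _ => f) (PiTensorProduct.reindex k (fun _ => X) σ t) := by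
  induction t using PiTensorProduct.induction_on with
  | smul_tprod r x =>
    simp only [map_smul, PiTensorProduct.map_tprod, PiTensorProduct.reindex_tprod]
  | add x y hx hy => simp only [map_add, hx, hy]

/-- The map `Γ^d(f)` induced by a linear map `f`. -/
def symTensorsMap (f : X →ₗ[k] Y) : symTensors k d X →ₗ[k] symTensors k d Y :=
  (PiTensorProduct.map (fun _ => f)).restrict fun t ht σ => by rw [reindex_map, ht σ]

theorem reindex_map₂ (B : X →ₗ[k] Y →ₗ[k] Z) (σ : Equiv.Perm (Fin d)) (s : ⨂[k] _ : Fin d, X)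
    (t : ⨂[k] _ : Fin d, Y) :
    PiTensorProduct.reindex k (fun _ => Z) σ (PiTensorProduct.map₂ (fun _ => B) s t) =
      PiTensorProduct.map₂ (fun _ => B) (PiTensorProduct.reindex k (fun _ => X) σ s)
        (PiTensorProduct.reindex k (fun _ => Y) σ t) := by
  induction s using PiTensorProduct.induction_on with
  | smul_tprod r x =>
    induction t using PiTensorProduct.induction_on with
    | smul_tprod r x =>
      simp only [map_smul, LinearMap.smul_apply, PiTensorProduct.map₂_tprod_tprod,
        PiTensorProduct.reindex_tprod]
    | add x y hx hy => simp only [map_add, hx, hy]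
  | add x y hx hy => simp only [map_add, LinearMap.add_apply, hx, hy]

/-- The pairing `Γ^d(X) × Γ^d(Y) → Γ^d(Z)` induced by a bilinear map `X × Y → Z`. -/
def symTensorsMap₂ (B : X →ₗ[k] Y →ₗ[k] Z) (s : symTensors k d X) (t : symTensors k d Y) :
    symTensors k d Z :=
  ⟨PiTensorProduct.map₂ (fun _ => B) s.1 t.1, fun σ => by rw [reindex_map₂, s.2 σ, t.2 σ]⟩

/-- The symmetric tensor `x ⊗ ⋯ ⊗ x`. -/
def symPow (x : X) : symTensors k d X :=
  ⟨PiTensorProduct.tprod k fun _ => x, fun σ => by rw [PiTensorProduct.reindex_tprod]⟩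

variable {k}

/-- If `X = ⨁ N n` is graded, the degree `n` part of `X^{⊗ d}` is spanned by the tensors of
homogeneous elements whose degrees add up to `n`. -/
def tensorDeg (N : ℤ → Submodule k X) (n : ℤ) : Submodule k (⨂[k] _ : Fin d, X) :=
  Submodule.span k {t | ∃ (a : Fin d → ℤ) (x : Fin d → X), (∀ i, x i ∈ N (a i)) ∧
    ∑ i, a i = n ∧ t = PiTensorProduct.tprod k x}

/-- The induced grading of `Γ^d(X)`. -/
def symDeg (N : ℤ → Submodule k X) (n : ℤ) : Submodule k (symTensors k d X) :=
  (tensorDeg d N n).comap (symTensors k d X).subtype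

variable {N : ℤ → Submodule k X}

/-- Auxiliary: `X^{⊗ d}` as the direct sum of the multigraded pieces. -/
def tensorEquiv (h : DirectSum.IsInternal N) : (⨂[k] _ : Fin d, X) ≃ₗ[k]
    DirectSum (Fin d → ℤ) fun a => ⨂[k] i, N (a i) :=
  letI := h.chooseDecomposition
  (PiTensorProduct.congr fun _ => DirectSum.decomposeLinearEquiv N) ≪≫ₗ
    PiTensorProduct.ofDirectSumEquiv

theorem tensorEquiv_symm (h : DirectSum.IsInternal N) (a : Fin d → ℤ) (x : ∀ i, N (a i)) :
    (tensorEquiv d h).symm (DirectSum.lof k _ (fun a : Fin d → ℤ => ⨂[k] i, N (a i)) a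
      (PiTensorProduct.tprod k x)) = PiTensorProduct.tprod k fun i => (x i : X) := by
  let := h.chooseDecomposition
  simp only [tensorEquiv, LinearEquiv.trans_symm, LinearEquiv.trans_apply]
  erw [PiTensorProduct.ofDirectSumEquiv_symm_lof_tprod, PiTensorProduct.congr_symm_tprod]
  congr 1
  funext i
  exact DirectSum.decompose_symm_of N (x i)

theorem tensorDeg_iSup (h : DirectSum.IsInternal N) : ⨆ n, tensorDeg d N n = ⊤ := by
  classical
  rw [eq_top_iff]
  intro t _
  obtain ⟨y, rfl⟩ := (tensorEquiv d h).symm.surjective t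
  induction y using DirectSum.induction_on with
  | zero => simp
  | add x y hx hy => rw [map_add]; exact Submodule.add_mem _ (hx trivial) (hy trivial)
  | of a x =>
    induction x using PiTensorProduct.induction_on with
    | smul_tprod r x =>
      change (tensorEquiv d h).symm (DirectSum.lof k _ (fun a : Fin d → ℤ => ⨂[k] i, N (a i)) a
        _) ∈ _
      rw [map_smul, map_smul, tensorEquiv_symm]
      exact Submodule.smul_mem _ _ (Submodule.mem_iSup_of_mem (∑ i, a i)
        (Submodule.subset_span ⟨a, _, fun i => (x i).2, rfl, rfl⟩))
    | add x y hx hy =>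
      rw [map_add, map_add]
      exact Submodule.add_mem _ (hx trivial) (hy trivial)

theorem tensorDeg_isInternal (h : DirectSum.IsInternal N) : DirectSum.IsInternal (tensorDeg d N) := by
  classical
  let P (n : ℤ) : (⨂[k] _ : Fin d, X) →ₗ[k] ⨂[k] _ : Fin d, X :=
    (tensorEquiv d h).symm.toLinearMap ∘ₗ
      DFinsupp.filterLinearMap k (fun a : Fin d → ℤ => ⨂[k] i, N (a i))
        (fun a => ∑ i, a i = n) ∘ₗ (tensorEquiv d h).toLinearMap
  have key : ∀ (n : ℤ) (a : Fin d → ℤ) (x : Fin d → X), (∀ i, x i ∈ N (a i)) →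
      P n (PiTensorProduct.tprod k x) =
        if ∑ i, a i = n then PiTensorProduct.tprod k x else 0 := by
    intro n a x hx
    have e := tensorEquiv_symm d h a (fun i => ⟨x i, hx i⟩)
    simp only [P, LinearMap.comp_apply]
    simp only at e
    rw [← e]
    simp only [LinearEquiv.coe_coe, LinearEquiv.apply_symm_apply]
    have : DFinsupp.filterLinearMap k (fun a : Fin d → ℤ => ⨂[k] i, N (a i))
        (fun a => ∑ i, a i = n) (DirectSum.lof k _ (fun a : Fin d → ℤ => ⨂[k] i, N (a i)) a
        (PiTensorProduct.tprod k (fun i => ⟨x i, hx i⟩))) = if ∑ i, a i = n then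
        (DirectSum.lof k _ (fun a : Fin d → ℤ => ⨂[k] i, N (a i)) a
        (PiTensorProduct.tprod k (fun i => ⟨x i, hx i⟩))) else 0 := by
      convert! DFinsupp.filter_single (β := fun a : Fin d → ℤ => ⨂[k] i, N (a i))
        (fun a => ∑ i, a i = n) a _
    rw [this]
    split_ifs
    · rfl
    · simp
  refine isInternal_of_projections _ P ?_ ?_ (tensorDeg_iSup d h)
  · intro n t ht
    induction ht using Submodule.span_induction with
    | mem t ht =>
      obtain ⟨a, x, hx, ha, rfl⟩ := ht
      rw [key n a x hx, if_pos ha]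
    | zero => simp
    | add x y _ _ hx hy => rw [map_add, hx, hy]
    | smul c x _ hx => rw [map_smul, hx]
  · intro m n hmn t ht
    induction ht using Submodule.span_induction with
    | mem t ht =>
      obtain ⟨a, x, hx, ha, rfl⟩ := ht
      rw [key n a x hx, if_neg (ha ▸ hmn)]
    | zero => simp
    | add x y _ _ hx hy => rw [map_add, hx, hy, add_zero]
    | smul c x _ hx => rw [map_smul, hx, smul_zero]

theorem symDeg_isInternal (h : DirectSum.IsInternal N) : DirectSum.IsInternal (symDeg d N) := by
  refine isInternal_comap (tensorDeg_isInternal d h) _ fun n t ht σ => ?_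
  have := gproj_comm (tensorDeg_isInternal d h) (tensorDeg_isInternal d h)
    (PiTensorProduct.reindex k (fun _ => X) σ).toLinearMap (fun n t ht => ?_) n t
  · simp only [LinearEquiv.coe_coe] at this
    rw [← this, ht σ]
  · induction ht using Submodule.span_induction with
    | mem t ht =>
      obtain ⟨a, x, hx, ha, rfl⟩ := ht
      refine Submodule.subset_span ⟨a ∘ σ.symm, x ∘ σ.symm, fun i => hx _, ?_, ?_⟩
      · rw [← ha]; exact Equiv.sum_comp σ.symm a
      · exact PiTensorProduct.reindex_tprod _ _
    | zero => simp
    | add x y _ _ hx hy => rw [map_add]; exact Submodule.add_mem _ hx hy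
    | smul c x _ hx => rw [map_smul]; exact Submodule.smul_mem _ _ hx

end SymmetricTensors

section GradedCategories

variable (k : Type u) [Field k]

/-- Composition of `C` as a bilinear map. -/
def compBilin {C : Type w} [Category.{v} C] [Preadditive C] [Linear k C] (X Y Z : C) : (X ⟶ Y) →ₗ[k] (Y ⟶ Z) →ₗ[k] (X ⟶ Z) :=
  LinearMap.mk₂ k (fun f g => f ≫ g) (fun _ _ _ => Preadditive.add_comp _ _ _ _ _ _)
    (fun _ _ _ => Linear.smul_comp _ _ _ _ _ _) (fun _ _ _ => Preadditive.comp_add _ _ _ _ _ _)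
    (fun _ _ _ => Linear.comp_smul _ _ _ _ _ _)

/-- A (`ℤ`-)graded `k`-linear category: every Hom space is the direct sum of its homogeneous parts,
identities have degree `0`, and degrees add up under composition. -/
class GradedLinear (C : Type w) [Category.{v} C] [Preadditive C] [Linear k C] where
  homDeg (X Y : C) : ℤ → Submodule k (X ⟶ Y)
  isInternal (X Y : C) : DirectSum.IsInternal (homDeg X Y)
  id_mem (X : C) : 𝟙 X ∈ homDeg X X 0
  comp_mem {X Y Z : C} {m n : ℤ} {f : X ⟶ Y} {g : Y ⟶ Z} :
    f ∈ homDeg X Y m → g ∈ homDeg Y Z n → f ≫ g ∈ homDeg X Z (m + n)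

/-- A graded functor: `k`-linear and degree preserving on Hom spaces. -/
structure IsGradedFunctor {C : Type*} [Category* C] [Preadditive C] [Linear k C] [GradedLinear k C]
    {D : Type*} [Category* D] [Preadditive D] [Linear k D] [GradedLinear k D]
    (F : C ⥤ D) : Prop where
  linear (X Y : C) : IsLinearMap k (F.map : (X ⟶ Y) → (F.obj X ⟶ F.obj Y))
  map_mem {X Y : C} {n : ℤ} {f : X ⟶ Y} :
    f ∈ GradedLinear.homDeg (k := k) X Y n →
      F.map f ∈ GradedLinear.homDeg (k := k) (F.obj X) (F.obj Y) n

/-- An object of `V^{f+}`: a `ℤ`-graded `k`-space, bounded below and finite dimensional in each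
degree. -/
structure GrVect where
  carrier : Type u
  [addCommGroup : AddCommGroup carrier]
  [module : Module k carrier]
  deg : ℤ → Submodule k carrier
  isInternal : DirectSum.IsInternal deg
  finite : ∀ n, Module.Finite k (deg n)
  bddBelow : ∃ b : ℤ, ∀ n < b, deg n = ⊥

attribute [instance] GrVect.addCommGroup GrVect.module

namespace GrVect

variable {k}

section

variable {M M' : Type*} [AddCommGroup M] [Module k M] [AddCommGroup M'] [Module k M']

/-- The linear maps of degree `n` between spaces with gradings `N`, `N'`. -/
def mapDeg (N : ℤ → Submodule k M) (N' : ℤ → Submodule k M') (n : ℤ) :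
    Submodule k (M →ₗ[k] M') where
  carrier := {f | ∀ i, ∀ x ∈ N i, f x ∈ N' (i + n)}
  add_mem' hf hg i x hx := Submodule.add_mem _ (hf i x hx) (hg i x hx)
  zero_mem' _ _ _ := Submodule.zero_mem _
  smul_mem' c _ hf i x hx := Submodule.smul_mem _ c (hf i x hx)

/-- The finite sums of homogeneous linear maps. -/
def mapGr (N : ℤ → Submodule k M) (N' : ℤ → Submodule k M') : Submodule k (M →ₗ[k] M') :=
  ⨆ n, mapDeg N N' n

end

/-- The linear maps of degree `n`. -/
abbrev linDeg (X Y : GrVect k) (n : ℤ) : Submodule k (X.carrier →ₗ[k] Y.carrier) :=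
  mapDeg X.deg Y.deg n

/-- The graded Hom space: finite sums of homogeneous linear maps. -/
abbrev gradedHom (X Y : GrVect k) : Submodule k (X.carrier →ₗ[k] Y.carrier) :=
  mapGr X.deg Y.deg

theorem linDeg_comp {X Y Z : GrVect k} {m n : ℤ} {f : X.carrier →ₗ[k] Y.carrier}
    {g : Y.carrier →ₗ[k] Z.carrier} (hf : f ∈ linDeg X Y m) (hg : g ∈ linDeg Y Z n) :
    g ∘ₗ f ∈ linDeg X Z (m + n) := by
  intro i x hx
  rw [← add_assoc]
  exact hg _ _ (hf i x hx)

theorem linDeg_id (X : GrVect k) : LinearMap.id ∈ linDeg X X 0 := by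
  intro i x hx
  simpa using hx

theorem gradedHom_comp {X Y Z : GrVect k} {f : X.carrier →ₗ[k] Y.carrier}
    {g : Y.carrier →ₗ[k] Z.carrier} (hf : f ∈ gradedHom X Y) (hg : g ∈ gradedHom Y Z) :
    g ∘ₗ f ∈ gradedHom X Z := by
  unfold gradedHom mapGr at hf hg
  induction hf using Submodule.iSup_induction' with
  | zero => simp
  | add a b _ _ ha hb => rw [LinearMap.comp_add]; exact Submodule.add_mem _ ha hb
  | mem m a ha =>
    induction hg using Submodule.iSup_induction' with
    | zero => simp
    | add a b _ _ ha hb => rw [LinearMap.add_comp]; exact Submodule.add_mem _ ha hb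
    | mem n b hb => exact Submodule.mem_iSup_of_mem (m + n) (linDeg_comp ha hb)

theorem linDeg_iSupIndep (X Y : GrVect k) : iSupIndep (linDeg X Y) := by
  intro n
  rw [Submodule.disjoint_def]
  intro f hf hf'
  have key : ∀ i, ∀ x ∈ X.deg i, f x = 0 := by
    intro i x hx
    have h1 : f x ∈ ⨆ m, ⨆ (_ : m ≠ n), Y.deg (i + m) := by
      clear hf
      induction hf' using Submodule.iSup_induction' with
      | zero => simp
      | add a b _ _ ha hb => exact Submodule.add_mem _ ha hb
      | mem m a ha =>
        by_cases e : m = n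
        · simp only [e, ne_eq, not_true_eq_false, iSup_false, Submodule.mem_bot] at ha
          simp [ha]
        · simp only [ne_eq, e, not_false_eq_true, iSup_pos] at ha
          exact Submodule.mem_iSup_of_mem m (Submodule.mem_iSup_of_mem e (ha i x hx))
    have h2 := (Y.isInternal.submodule_iSupIndep.comp (add_right_injective i)) n
    exact (Submodule.disjoint_def.1 h2) _ (hf i x hx) h1
  ext x
  have hx : x ∈ ⨆ n, X.deg n := by rw [X.isInternal.submodule_iSup_eq_top]; trivial
  induction hx using Submodule.iSup_induction' with
  | zero => simp
  | add a b _ _ ha hb => rw [map_add, ha, hb, map_add]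
  | mem m a ha => exact key m a ha

/-- `V^{f+}` with graded Hom spaces. -/
instance : Category.{u} (GrVect k) where
  Hom X Y := gradedHom X Y
  id X := ⟨LinearMap.id, Submodule.mem_iSup_of_mem 0 (linDeg_id X)⟩
  comp f g := ⟨g.1 ∘ₗ f.1, gradedHom_comp f.2 g.2⟩

instance : Preadditive (GrVect k) where
  homGroup X Y := inferInstanceAs (AddCommGroup (gradedHom X Y))
  add_comp _ _ _ f f' g := Subtype.ext (LinearMap.comp_add f.1 f'.1 g.1)
  comp_add _ _ _ f g g' := Subtype.ext (LinearMap.add_comp f.1 g'.1 g.1)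

instance : Linear k (GrVect k) where
  homModule X Y := inferInstanceAs (Module k (gradedHom X Y))
  smul_comp _ _ _ c f g := Subtype.ext (LinearMap.comp_smul g.1 c f.1)
  comp_smul _ _ _ f c g := Subtype.ext (LinearMap.smul_comp c g.1 f.1)

instance : GradedLinear k (GrVect k) where
  homDeg X Y n := (linDeg X Y n).comap (gradedHom X Y).subtype
  isInternal X Y := by
    apply DirectSum.isInternal_submodule_of_iSupIndep_of_iSup_eq_top
    · have h := linDeg_iSupIndep X Y
      intro n
      rw [Submodule.disjoint_def]
      intro f hf hf'
      refine Subtype.ext ((Submodule.disjoint_def.1 (h n)) f.1 hf ?_)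
      have : (⨆ j, ⨆ (_ : j ≠ n), (linDeg X Y j).comap (gradedHom X Y).subtype) ≤
          (⨆ j, ⨆ (_ : j ≠ n), linDeg X Y j).comap (gradedHom X Y).subtype :=
        iSup₂_le fun j hj => Submodule.comap_mono (le_iSup₂_of_le j hj le_rfl)
      exact this hf'
    · rw [eq_top_iff]
      rintro ⟨f, hf⟩ -
      have hf' := hf
      unfold gradedHom mapGr at hf'
      induction hf' using Submodule.iSup_induction' with
      | mem n f h => exact Submodule.mem_iSup_of_mem n h
      | zero => exact Submodule.zero_mem _
      | add a b ha hb h1 h2 => exact Submodule.add_mem _ (h1 ha) (h2 hb)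
  id_mem X := linDeg_id X
  comp_mem hf hg := linDeg_comp hf hg

theorem hom_ext {X Y : GrVect k} {f g : X ⟶ Y} (h : f.1 = g.1) : f = g := Subtype.ext h

theorem id_val (X : GrVect k) : (𝟙 X : X ⟶ X).1 = LinearMap.id := rfl

theorem comp_val {X Y Z : GrVect k} (f : X ⟶ Y) (g : Y ⟶ Z) : (f ≫ g).1 = g.1 ∘ₗ f.1 := rfl

theorem add_val {X Y : GrVect k} (f g : X ⟶ Y) : (f + g).1 = f.1 + g.1 := rfl

theorem smul_val {X Y : GrVect k} (c : k) (f : X ⟶ Y) : (c • f).1 = c • f.1 := rfl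

end GrVect

variable (C : Type w) [Category.{v} C] [Preadditive C] [Linear k C] [GradedLinear k C]

/-- The graded functors `C ⥤ V^{f+}`. -/
def gradedFunctors : ObjectProperty (C ⥤ GrVect k) := fun F => IsGradedFunctor k F

/-- The category of graded `k`-linear functors `C ⥤ V^{f+}` and natural transformations. -/
abbrev GrFun := (gradedFunctors k C).FullSubcategory

variable {k C} in
/-- The homogeneous natural transformations of degree `n`. -/
def natDeg (F G : GrFun k C) (n : ℤ) : Submodule k (F ⟶ G) where
  carrier := {φ | ∀ X, φ.hom.app X ∈ GradedLinear.homDeg (k := k) (F.obj.obj X) (G.obj.obj X) n}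
  add_mem' hf hg X := Submodule.add_mem _ (hf X) (hg X)
  zero_mem' _ := Submodule.zero_mem _
  smul_mem' c _ hf X := Submodule.smul_mem _ c (hf X)

variable {k C} in
/-- Precomposition with a graded functor. -/
def precomp {D : Type*} [Category* D] [Preadditive D] [Linear k D] [GradedLinear k D]
    (T : C ⥤ D) (hT : IsGradedFunctor k T) : GrFun k D ⥤ GrFun k C where
  obj F := ⟨T ⋙ F.obj,
    { linear X Y := ⟨fun f g => by
          simp only [Functor.comp_map, (hT.linear X Y).map_add, (F.property.linear _ _).map_add],
        fun c f => by
          simp only [Functor.comp_map, (hT.linear X Y).map_smul, (F.property.linear _ _).map_smul]⟩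
      map_mem hf := F.property.map_mem (hT.map_mem hf) }⟩
  map φ := ObjectProperty.homMk (Functor.whiskerLeft T φ.hom)

section Representable

variable {k}
variable {C : Type w} [Category.{u} C] [Preadditive C] [Linear k C] [GradedLinear k C]

open GradedLinear in
theorem rightComp_mem {X Y : C} (U : C) {n : ℤ} {g : X ⟶ Y} (hg : g ∈ homDeg (k := k) X Y n) :
    ∀ i, ∀ x ∈ homDeg (k := k) U X i, x ≫ g ∈ homDeg (k := k) U Y (i + n) :=
  fun _ _ hx => comp_mem hx hg

variable [∀ X Y : C, Module.Finite k (X ⟶ Y)]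

variable (k) in
/-- The graded space `Hom(U, Y)`. -/
def homGrVect (U Y : C) : GrVect k where
  carrier := U ⟶ Y
  deg := GradedLinear.homDeg U Y
  isInternal := GradedLinear.isInternal U Y
  finite n := inferInstance
  bddBelow := by
    have h := GradedLinear.isInternal (k := k) U Y
    have hf := WellFoundedGT.finite_ne_bot_of_iSupIndep h.submodule_iSupIndep
    obtain ⟨b, hb⟩ := hf.bddBelow
    refine ⟨b, fun n hn => ?_⟩
    by_contra hne
    exact absurd (hb hne) (not_le.2 hn)

theorem rightComp_gradedHom {X Y : C} (U : C) (g : X ⟶ Y) :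
    Linear.rightComp k U g ∈ (homGrVect k U X).gradedHom (homGrVect k U Y) := by
  let Φ : (X ⟶ Y) →ₗ[k] ((homGrVect k U X).carrier →ₗ[k] (homGrVect k U Y).carrier) :=
    (compBilin k U X Y).flip
  have h : (⊤ : Submodule k (X ⟶ Y)) ≤
      ((homGrVect k U X).gradedHom (homGrVect k U Y)).comap Φ := by
    rw [← (GradedLinear.isInternal X Y).submodule_iSup_eq_top]
    exact iSup_le fun n g hg => Submodule.mem_iSup_of_mem n (rightComp_mem U hg)
  exact h (Submodule.mem_top (x := g))

theorem leftComp_gradedHom {X Y : C} (U : C) (g : X ⟶ Y) :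
    Linear.leftComp k U g ∈ (homGrVect k Y U).gradedHom (homGrVect k X U) := by
  let Φ : (X ⟶ Y) →ₗ[k] ((homGrVect k Y U).carrier →ₗ[k] (homGrVect k X U).carrier) :=
    compBilin k X Y U
  have h : (⊤ : Submodule k (X ⟶ Y)) ≤
      ((homGrVect k Y U).gradedHom (homGrVect k X U)).comap Φ := by
    rw [← (GradedLinear.isInternal X Y).submodule_iSup_eq_top]
    refine iSup_le fun n g hg => Submodule.mem_iSup_of_mem n fun i x hx => ?_
    rw [add_comm]
    exact GradedLinear.comp_mem hg hx
  exact h (Submodule.mem_top (x := g))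

variable (k C) in
/-- The functor sending `U` to the representable functor `Y ↦ Hom(U, Y)`, and a morphism
`U' ⟶ U` to precomposition with it. -/
def representable : Cᵒᵖ ⥤ GrFun k C where
  obj U :=
    { obj :=
        { obj Y := homGrVect k U.unop Y
          map g := ⟨Linear.rightComp k U.unop g, rightComp_gradedHom U.unop g⟩
          map_id Y := Subtype.ext (LinearMap.ext fun f => Category.comp_id f)
          map_comp g h := Subtype.ext (LinearMap.ext fun f => (Category.assoc f g h).symm) }
      property :=
        { linear X Y :=
            ⟨fun g h => Subtype.ext (LinearMap.ext fun f => Preadditive.comp_add _ _ _ f g h),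
             fun c g => Subtype.ext (LinearMap.ext fun f => Linear.comp_smul _ _ _ f c g)⟩
          map_mem hf := rightComp_mem U.unop hf } }
  map f := ObjectProperty.homMk
    { app Y := ⟨Linear.leftComp k Y f.unop, leftComp_gradedHom Y f.unop⟩
      naturality X Y g := Subtype.ext (LinearMap.ext fun h => (Category.assoc f.unop h g).symm) }
  map_id U := by
    apply ObjectProperty.hom_ext
    ext Y
    exact Subtype.ext (LinearMap.ext fun h => Category.id_comp h)
  map_comp f g := by
    apply ObjectProperty.hom_ext
    ext Y
    exact Subtype.ext (LinearMap.ext fun h => Category.assoc g.unop f.unop h)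

end Representable

end GradedCategories

section DividedPowers

/-- The category `Γ^d C` of a `k`-linear category `C`: it has the objects of `C`, and
`Hom(X, Y) = Γ^d(Hom_C(X, Y))`. -/
structure GammaCat (k : Type u) (d : ℕ) (C : Type w) where
  obj : C

namespace GammaCat

variable {k : Type u} [Field k] {d : ℕ}
variable {C : Type w} [Category.{v} C] [Preadditive C] [Linear k C]

theorem map₂_comp_assoc {X Y Z W : C} (r : ⨂[k] _ : Fin d, (X ⟶ Y)) (s : ⨂[k] _ : Fin d, (Y ⟶ Z))
    (t : ⨂[k] _ : Fin d, (Z ⟶ W)) :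
    PiTensorProduct.map₂ (fun _ => compBilin k X Z W)
        (PiTensorProduct.map₂ (fun _ => compBilin k X Y Z) r s) t =
      PiTensorProduct.map₂ (fun _ => compBilin k X Y W) r
        (PiTensorProduct.map₂ (fun _ => compBilin k Y Z W) s t) := by
  induction r using PiTensorProduct.induction_on with
  | add x y hx hy => simp only [map_add, LinearMap.add_apply, hx, hy]
  | smul_tprod a x =>
    induction s using PiTensorProduct.induction_on with
    | add x y hx hy => simp only [map_add, LinearMap.add_apply, hx, hy]
    | smul_tprod b y =>
      induction t using PiTensorProduct.induction_on with
      | add x y hx hy => simp only [map_add, hx, hy]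
      | smul_tprod c z =>
        simp only [map_smul, LinearMap.smul_apply, PiTensorProduct.map₂_tprod_tprod, compBilin,
          LinearMap.mk₂_apply, Category.assoc]

theorem map₂_id_comp {X Y : C} (t : ⨂[k] _ : Fin d, (X ⟶ Y)) :
    PiTensorProduct.map₂ (fun _ => compBilin k X X Y) (PiTensorProduct.tprod k fun _ => 𝟙 X) t =
      t := by
  induction t using PiTensorProduct.induction_on with
  | add x y hx hy => simp only [map_add, hx, hy]
  | smul_tprod b y =>
    simp only [map_smul, PiTensorProduct.map₂_tprod_tprod, compBilin,
      LinearMap.mk₂_apply, Category.id_comp]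

theorem map₂_comp_id {X Y : C} (t : ⨂[k] _ : Fin d, (X ⟶ Y)) :
    PiTensorProduct.map₂ (fun _ => compBilin k X Y Y) t (PiTensorProduct.tprod k fun _ => 𝟙 Y) =
      t := by
  induction t using PiTensorProduct.induction_on with
  | add x y hx hy => simp only [map_add, LinearMap.add_apply, hx, hy]
  | smul_tprod b y =>
    simp only [map_smul, LinearMap.smul_apply, PiTensorProduct.map₂_tprod_tprod, compBilin,
      LinearMap.mk₂_apply, Category.comp_id]

instance : Category.{max u v} (GammaCat k d C) where
  Hom X Y := symTensors k d (X.obj ⟶ Y.obj)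
  id X := symPow k d (𝟙 X.obj)
  comp f g := symTensorsMap₂ k d (compBilin k _ _ _) f g
  id_comp f := Subtype.ext (map₂_id_comp f.1)
  comp_id f := Subtype.ext (map₂_comp_id f.1)
  assoc f g h := Subtype.ext (map₂_comp_assoc f.1 g.1 h.1)

theorem comp_val {X Y Z : GammaCat k d C} (f : X ⟶ Y) (g : Y ⟶ Z) :
    (f ≫ g).1 = PiTensorProduct.map₂ (fun _ => compBilin k X.obj Y.obj Z.obj) f.1 g.1 := rfl

theorem id_val (X : GammaCat k d C) :
    (𝟙 X : X ⟶ X).1 = PiTensorProduct.tprod k fun _ => 𝟙 X.obj := rfl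

instance : Preadditive (GammaCat k d C) where
  homGroup X Y := inferInstanceAs (AddCommGroup (symTensors k d (X.obj ⟶ Y.obj)))
  add_comp X Y Z f f' g := Subtype.ext <| LinearMap.map_add₂
    (PiTensorProduct.map₂ (fun _ => compBilin k X.obj Y.obj Z.obj)) f.1 f'.1 g.1
  comp_add X Y Z f g g' := Subtype.ext <|
    (PiTensorProduct.map₂ (fun _ => compBilin k X.obj Y.obj Z.obj) f.1).map_add g.1 g'.1

instance : Linear k (GammaCat k d C) where
  homModule X Y := inferInstanceAs (Module k (symTensors k d (X.obj ⟶ Y.obj)))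
  smul_comp X Y Z c f g := Subtype.ext <| LinearMap.map_smul₂
    (PiTensorProduct.map₂ (fun _ => compBilin k X.obj Y.obj Z.obj)) c f.1 g.1
  comp_smul X Y Z f c g := Subtype.ext <|
    (PiTensorProduct.map₂ (fun _ => compBilin k X.obj Y.obj Z.obj) f.1).map_smul c g.1

theorem sum_val {X Y : GammaCat k d C} {ι : Type*} (s : Finset ι) (f : ι → (X ⟶ Y)) :
    (∑ i ∈ s, f i).1 = ∑ i ∈ s, (f i).1 :=
  map_sum (symTensors k d (X.obj ⟶ Y.obj)).subtype f s

instance (X Y : GammaCat k d C) [Module.Finite k (X.obj ⟶ Y.obj)] : Module.Finite k (X ⟶ Y) :=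
  inferInstanceAs (Module.Finite k (symTensors k d (X.obj ⟶ Y.obj)))

/-- If `C` is graded then so is `Γ^d C`. -/
instance [GradedLinear k C] : GradedLinear k (GammaCat k d C) where
  homDeg X Y := symDeg d (GradedLinear.homDeg X.obj Y.obj)
  isInternal X Y := symDeg_isInternal d (GradedLinear.isInternal X.obj Y.obj)
  id_mem X := Submodule.subset_span ⟨fun _ => 0, _, fun _ => GradedLinear.id_mem X.obj, by simp, rfl⟩
  comp_mem {X Y Z m n f g} hf hg := by
    obtain ⟨f, hf'⟩ := f
    obtain ⟨g, hg'⟩ := g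
    change f ∈ tensorDeg d _ m at hf
    change g ∈ tensorDeg d _ n at hg
    change PiTensorProduct.map₂ (fun _ => compBilin k X.obj Y.obj Z.obj) f g ∈ tensorDeg d _ (m + n)
    clear hf' hg'
    induction hf using Submodule.span_induction with
    | zero => simp
    | add x y _ _ hx hy =>
      rw [LinearMap.map_add₂]; exact Submodule.add_mem _ hx hy
    | smul c x _ hx => rw [LinearMap.map_smul₂]; exact Submodule.smul_mem _ _ hx
    | mem f hf =>
      induction hg using Submodule.span_induction with
      | zero => simp
      | add x y _ _ hx hy => rw [map_add]; exact Submodule.add_mem _ hx hy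
      | smul c x _ hx => rw [map_smul]; exact Submodule.smul_mem _ _ hx
      | mem g hg =>
        obtain ⟨a, x, hx, ha, rfl⟩ := hf
        obtain ⟨b, y, hy, hb, rfl⟩ := hg
        rw [PiTensorProduct.map₂_tprod_tprod]
        exact Submodule.subset_span ⟨fun i => a i + b i, _,
          fun i => GradedLinear.comp_mem (hx i) (hy i), by rw [Finset.sum_add_distrib, ha, hb], rfl⟩

variable {D : Type*} [Category* D] [Preadditive D] [Linear k D]

variable (k d) in
/-- The functor `Γ^d C ⥤ Γ^d D` induced by a `k`-linear functor `C ⥤ D`. -/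
def mapFunctor (F : C ⥤ D) [F.Additive] [F.Linear k] : GammaCat k d C ⥤ GammaCat k d D where
  obj X := ⟨F.obj X.obj⟩
  map {X Y} f := symTensorsMap k d (F.mapLinearMap k (X := X.obj) (Y := Y.obj)) f
  map_id X := by
    apply Subtype.ext
    change PiTensorProduct.map _ (PiTensorProduct.tprod k _) = PiTensorProduct.tprod k _
    rw [PiTensorProduct.map_tprod]
    simp
  map_comp {X Y Z} f g := by
    apply Subtype.ext
    change PiTensorProduct.map _ (PiTensorProduct.map₂ _ f.1 g.1) =
      PiTensorProduct.map₂ _ (PiTensorProduct.map _ f.1) (PiTensorProduct.map _ g.1)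
    generalize f.1 = f
    generalize g.1 = g
    induction f using PiTensorProduct.induction_on with
    | add x y hx hy => simp only [map_add, LinearMap.add_apply, hx, hy]
    | smul_tprod b y =>
      induction g using PiTensorProduct.induction_on with
      | add x y hx hy => simp only [map_add, hx, hy]
      | smul_tprod c z =>
        simp [PiTensorProduct.map₂_tprod_tprod, compBilin]

theorem mapFunctor_val (F : C ⥤ D) [F.Additive] [F.Linear k] {X Y : GammaCat k d C} (f : X ⟶ Y) :
    ((mapFunctor k d F).map f).1 =
      PiTensorProduct.map (fun _ => F.mapLinearMap k (X := X.obj) (Y := Y.obj)) f.1 := rfl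

theorem mapFunctor_linear (F : C ⥤ D) [F.Additive] [F.Linear k] (X Y : GammaCat k d C) :
    IsLinearMap k ((mapFunctor k d F).map : (X ⟶ Y) → _) :=
  (symTensorsMap k d (F.mapLinearMap k (X := X.obj) (Y := Y.obj))).isLinear

theorem mapFunctor_isGraded [GradedLinear k C] [GradedLinear k D] (F : C ⥤ D) [F.Additive]
    [F.Linear k] (hF : IsGradedFunctor k F) : IsGradedFunctor k (mapFunctor k d F) where
  linear := mapFunctor_linear F
  map_mem {X Y n f} hf := by
    obtain ⟨f, hf'⟩ := f
    change f ∈ tensorDeg d _ n at hf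
    change PiTensorProduct.map (fun _ => F.mapLinearMap k (X := X.obj) (Y := Y.obj)) f ∈
      tensorDeg d _ n
    clear hf'
    induction hf using Submodule.span_induction with
    | zero => simp
    | add x y _ _ hx hy => rw [map_add]; exact Submodule.add_mem _ hx hy
    | smul c x _ hx => rw [map_smul]; exact Submodule.smul_mem _ _ hx
    | mem f hf =>
      obtain ⟨a, x, hx, ha, rfl⟩ := hf
      rw [PiTensorProduct.map_tprod]
      exact Submodule.subset_span ⟨a, _, fun i => hF.map_mem (hx i), ha, rfl⟩

section Weights

variable {J : Type*} [Fintype J] [DecidableEq J]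

/-- Auxiliary: the sum of the tensors `π_{s 1} ⊗ ⋯ ⊗ π_{s d}` over all `s : {1, …, d} → J` that take
each value `j` exactly `γ j` times. -/
def weightTensor {X : Type*} [AddCommGroup X] [Module k X] (π : J → X) (γ : J → ℕ) :
    ⨂[k] _ : Fin d, X :=
  ∑ s : Fin d → J with ∀ j, (Finset.univ.filter fun i => s i = j).card = γ j,
    PiTensorProduct.tprod k fun i => π (s i)

/-- For an object `X` with endomorphisms `π_j`, the coefficient `e_γ ∈ Γ^d(End X)` of
`∏ j, T_j ^ γ_j` in the `d`-th tensor power of `∑ j, T_j • π_j`. If the `π_j` are the projections of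
`X = ⨁ X^j`, the image of `F(e_γ)` is the part of `F(X)` of degree `γ_j` in `X^j`. -/
def weightIdem (X : C) (π : J → (X ⟶ X)) (γ : J → ℕ) :
    (⟨X⟩ : GammaCat k d C) ⟶ ⟨X⟩ :=
  ⟨weightTensor π γ, fun σ => by
    unfold weightTensor
    rw [map_sum]
    simp only [PiTensorProduct.reindex_tprod]
    refine Finset.sum_bij' (fun s _ => s ∘ σ.symm) (fun s _ => s ∘ σ) ?_ ?_ ?_ ?_ ?_
    · intro s hs
      simp only [Finset.mem_filter, Finset.mem_univ, true_and] at hs ⊢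
      intro j
      rw [← hs j]
      exact Finset.card_equiv σ.symm (by simp)
    · intro s hs
      simp only [Finset.mem_filter, Finset.mem_univ, true_and] at hs ⊢
      intro j
      rw [← hs j]
      exact Finset.card_equiv σ (by simp)
    · intro s _; funext i; simp
    · intro s _; funext i; simp
    · intro s _; rfl⟩

/-- The multi-indices `γ` with `∑ j, γ_j = d`. -/
abbrev MultiIndex (J : Type*) [Fintype J] (d : ℕ) := {γ : J → ℕ // ∑ j, γ j = d}

instance : Fintype (MultiIndex J d) :=
  Fintype.ofInjective (β := J → Fin (d + 1))
    (fun γ j => ⟨γ.1 j, Nat.lt_succ_of_le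
      ((Finset.single_le_sum (fun _ _ => Nat.zero_le _) (Finset.mem_univ j)).trans_eq γ.2)⟩)
    (fun γ γ' h => Subtype.ext (funext fun j => by simpa using congrFun h j))

theorem weight_sum (s : Fin d → J) (γ : J → ℕ)
    (h : ∀ j, (Finset.univ.filter fun i => s i = j).card = γ j) (wt : J → ℤ) :
    ∑ i, wt (s i) = ∑ j, (γ j : ℤ) * wt j := by
  rw [← Finset.sum_fiberwise Finset.univ s]
  refine Finset.sum_congr rfl fun j _ => ?_
  rw [← h j, ← nsmul_eq_mul, ← Finset.sum_const]
  refine Finset.sum_congr rfl fun i hi => ?_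
  rw [(Finset.mem_filter.1 hi).2]

theorem weightIdem_sum (X : C) (π : J → (X ⟶ X)) (h1 : ∑ j, π j = 𝟙 X) :
    ∑ γ : MultiIndex J d, weightIdem (k := k) X π γ.1 = 𝟙 (⟨X⟩ : GammaCat k d C) := by
  apply Subtype.ext
  rw [sum_val, id_val]
  simp only [weightIdem, weightTensor]
  rw [← h1, MultilinearMap.map_sum]
  rw [Finset.sum_sigma']
  refine Finset.sum_bij' (fun x _ => x.2) (fun s _ => ⟨⟨fun j =>
    (Finset.univ.filter fun i => s i = j).card, ?_⟩, s⟩) ?_ ?_ ?_ ?_ ?_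
  · rw [← Finset.card_eq_sum_card_fiberwise (fun _ _ => Finset.mem_coe.2 (Finset.mem_univ _))]
    simp
  · simp
  · simp
  · rintro ⟨⟨γ, hγ⟩, s⟩ hs
    simp only [Finset.mem_sigma, Finset.mem_univ, Finset.mem_filter, true_and] at hs
    have : (fun j => (Finset.univ.filter fun i => s i = j).card) = γ := funext hs
    subst this
    rfl
  · simp
  · simp

theorem weightIdem_comp (X : C) (π : J → (X ⟶ X)) (h2 : ∀ i, π i ≫ π i = π i)
    (h3 : ∀ i j, i ≠ j → π i ≫ π j = 0) (γ γ' : J → ℕ) :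
    weightIdem (k := k) (d := d) X π γ ≫ weightIdem X π γ' =
      if γ = γ' then weightIdem X π γ else 0 := by
  apply Subtype.ext
  rw [comp_val]
  have key : ∀ s t : Fin d → J, PiTensorProduct.map₂ (fun _ => compBilin k X X X)
      (PiTensorProduct.tprod k fun i => π (s i)) (PiTensorProduct.tprod k fun i => π (t i)) =
      if s = t then PiTensorProduct.tprod k fun i => π (s i) else 0 := by
    intro s t
    rw [PiTensorProduct.map₂_tprod_tprod]
    split_ifs with e
    · subst e
      congr 1
      funext i
      exact h2 _
    · obtain ⟨i, hi⟩ := Function.ne_iff.1 e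
      exact (PiTensorProduct.tprod k).map_coord_zero i (h3 _ _ hi)
  have hl : ∀ γ, (weightIdem (k := k) (d := d) X π γ).1 = weightTensor π γ := fun _ => rfl
  rw [hl, hl]
  simp only [weightTensor, map_sum, LinearMap.sum_apply, key]
  split_ifs with e
  · subst e
    change _ = weightTensor π γ
    unfold weightTensor
    refine Finset.sum_congr rfl fun s hs => ?_
    rw [Finset.sum_ite_eq' , if_pos hs]
  · refine Finset.sum_eq_zero fun s hs => Finset.sum_eq_zero fun t ht => if_neg fun est => e ?_
    subst est
    simp only [Finset.mem_filter, Finset.mem_univ, true_and] at hs ht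
    funext j
    rw [← hs, ← ht]

theorem weightIdem_comp_comp {X Y : C} (π : J → (X ⟶ X)) (ρ : J → (Y ⟶ Y)) (wt : J → ℤ)
    (N : ℤ → Submodule k (X ⟶ Y))
    (hN : ∀ n, ∀ f ∈ N n, ∀ i j, wt j ≠ wt i + n → π i ≫ f ≫ ρ j = 0)
    (n : ℤ) (f : (⟨X⟩ : GammaCat k d C) ⟶ ⟨Y⟩) (hf : f.1 ∈ tensorDeg d N n) (γ γ' : J → ℕ)
    (h : ∑ j, (γ' j : ℤ) * wt j ≠ ∑ j, (γ j : ℤ) * wt j + n) :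
    weightIdem X π γ ≫ f ≫ weightIdem Y ρ γ' = 0 := by
  apply Subtype.ext
  rw [comp_val, comp_val]
  change PiTensorProduct.map₂ _ (weightTensor π γ) (PiTensorProduct.map₂ _ f.1
    (weightTensor ρ γ')) = 0
  generalize f.1 = f at hf
  induction hf using Submodule.span_induction with
  | zero => simp
  | add x y _ _ hx hy => rw [LinearMap.map_add₂, map_add, hx, hy, add_zero]
  | smul c x _ hx => rw [LinearMap.map_smul₂, map_smul, hx, smul_zero]
  | mem f hf =>
    obtain ⟨a, x, hx, ha, rfl⟩ := hf
    unfold weightTensor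
    simp only [map_sum, LinearMap.sum_apply]
    refine Finset.sum_eq_zero fun t ht => Finset.sum_eq_zero fun s hs => ?_
    rw [PiTensorProduct.map₂_tprod_tprod, PiTensorProduct.map₂_tprod_tprod]
    simp only [Finset.mem_filter, Finset.mem_univ, true_and] at hs ht
    by_contra hne
    apply h
    rw [← weight_sum s γ hs, ← weight_sum t γ' ht, ← ha, ← Finset.sum_add_distrib]
    refine Finset.sum_congr rfl fun i _ => ?_
    by_contra hi
    exact hne ((PiTensorProduct.tprod k).map_coord_zero i (hN _ _ (hx i) _ _ hi))

end Weights

end GammaCat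

end DividedPowers

section AffineCategory

variable (k : Type u) [Field k] (p : ℕ)

/-- `V`, the finite dimensional `k`-spaces, is regarded as a graded category concentrated in
degree `0`. -/
instance : GradedLinear k (FGModuleCat.{u} k) where
  homDeg _ _ n := if n = 0 then ⊤ else ⊥
  isInternal _ _ := by
    refine isInternal_of_projections _ (fun n => if n = 0 then LinearMap.id else 0) ?_ ?_ ?_
    · intro n x hx
      split_ifs at hx ⊢ <;> simp_all
    · intro m n hmn x hx
      split_ifs at hx ⊢ <;> simp_all
    · exact eq_top_iff.2 (le_iSup_of_le 0 (by simp))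
  id_mem _ := by simp
  comp_mem {X Y Z m n f g} hf hg := by
    split_ifs at hf hg ⊢ <;> simp_all

/-- The truncated polynomial algebra `A = k[x]/(x^p)`. -/
abbrev TruncPoly : Type u := AdjoinRoot ((Polynomial.X : Polynomial k) ^ p)

/-- The class of the variable `x` in `A`. -/
abbrev xA : TruncPoly k p := AdjoinRoot.root _

/-- The basis `1, x, …, x^(p-1)` of `A`. -/
def xBasis : Module.Basis (Fin p) k (TruncPoly k p) :=
  (AdjoinRoot.powerBasis' (Polynomial.monic_X_pow (R := k) p)).basis.reindex
    (finCongr (by simp))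

theorem xBasis_apply (j : Fin p) : xBasis k p j = xA k p ^ (j : ℕ) := by
  simp [xBasis]

instance : Module.Finite k (TruncPoly k p) := Module.Finite.of_basis (xBasis k p)

/-- The objects of `V_A`: the free `A`-modules `V ⊗ A` for a finite dimensional `k`-space `V`. -/
structure VA (k : Type u) [Field k] (p : ℕ) where
  space : FGModuleCat.{u} k

namespace VA

variable {k p}

/-- The underlying `A`-module `V ⊗ A` (with the factor `A` written on the left). -/
abbrev mod (X : VA k p) : Type u := TruncPoly k p ⊗[k] X.space

/-- The grading of `V ⊗ A`, where `V` has degree `0` and `x` has degree `2`. -/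
def deg (X : VA k p) (n : ℤ) : Submodule k X.mod :=
  Submodule.span k {y | ∃ (j : ℕ) (v : X.space), 2 * (j : ℤ) = n ∧ y = (xA k p ^ j) ⊗ₜ[k] v}

/-- The projection of `V ⊗ A` onto its direct summand `V ⊗ x^j`. -/
def proj (X : VA k p) (j : Fin p) : X.mod →ₗ[k] X.mod :=
  (((xBasis k p).coord j).smulRight (xA k p ^ (j : ℕ))).rTensor X.space

theorem xA_pow_eq_zero {j : ℕ} (h : p ≤ j) : xA k p ^ j = 0 := by
  have : xA k p ^ p = 0 := by
    have := AdjoinRoot.eval₂_root ((Polynomial.X : Polynomial k) ^ p)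
    simpa using this
  rw [← Nat.add_sub_cancel' h, pow_add, this, zero_mul]

theorem proj_tmul (X : VA k p) (i j : Fin p) (v : X.space) :
    X.proj j ((xA k p ^ (i : ℕ)) ⊗ₜ v) =
      if i = j then (xA k p ^ (i : ℕ)) ⊗ₜ v else 0 := by
  rw [proj, LinearMap.rTensor_tmul, LinearMap.smulRight_apply, ← xBasis_apply,
    Module.Basis.coord_apply, Module.Basis.repr_self, Finsupp.single_apply]
  split_ifs with h
  · rw [h, one_smul, xBasis_apply]
  · rw [zero_smul, TensorProduct.zero_tmul]

theorem proj_mem (X : VA k p) (j : Fin p) (y : X.mod) : X.proj j y ∈ X.deg (2 * (j : ℤ)) := by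
  induction y using TensorProduct.induction_on with
  | zero => simp
  | add a b ha hb => rw [map_add]; exact Submodule.add_mem _ ha hb
  | tmul a v =>
    rw [proj, LinearMap.rTensor_tmul, LinearMap.smulRight_apply, ← TensorProduct.smul_tmul']
    exact Submodule.smul_mem _ _ (Submodule.subset_span ⟨j, v, rfl, rfl⟩)

theorem proj_same (X : VA k p) (j : Fin p) {y : X.mod} (hy : y ∈ X.deg (2 * (j : ℤ))) :
    X.proj j y = y := by
  induction hy using Submodule.span_induction with
  | zero => simp
  | add a b _ _ ha hb => rw [map_add, ha, hb]
  | smul c a _ ha => rw [map_smul, ha]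
  | mem y hy =>
    obtain ⟨i, v, hi, rfl⟩ := hy
    obtain rfl : i = j := by lia
    rw [proj_tmul, if_pos rfl]

theorem proj_ne (X : VA k p) (j : Fin p) {n : ℤ} (hn : n ≠ 2 * (j : ℤ)) {y : X.mod}
    (hy : y ∈ X.deg n) : X.proj j y = 0 := by
  induction hy using Submodule.span_induction with
  | zero => simp
  | add a b _ _ ha hb => rw [map_add, ha, hb, add_zero]
  | smul c a _ ha => rw [map_smul, ha, smul_zero]
  | mem y hy =>
    obtain ⟨i, v, hi, rfl⟩ := hy
    by_cases hp : i < p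
    · have := proj_tmul X ⟨i, hp⟩ j v
      rw [if_neg] at this
      · exact this
      · rintro rfl
        exact hn hi.symm
    · rw [xA_pow_eq_zero (not_lt.1 hp), TensorProduct.zero_tmul, map_zero]

theorem proj_sum (X : VA k p) : ∑ j, X.proj j = LinearMap.id := by
  refine LinearMap.ext fun y => ?_
  induction y using TensorProduct.induction_on with
  | zero => simp
  | add a b ha hb => rw [map_add, map_add, ha, hb]
  | tmul a v =>
    rw [LinearMap.sum_apply, LinearMap.id_apply]
    conv_rhs => rw [← (xBasis k p).sum_repr a, TensorProduct.sum_tmul]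
    refine Finset.sum_congr rfl fun j _ => ?_
    rw [proj, LinearMap.rTensor_tmul, LinearMap.smulRight_apply, xBasis_apply]
    rfl

/-- `V_A`, with `Hom(V ⊗ A, W ⊗ A) = Hom_A(V ⊗ A, W ⊗ A)`, the space of all `A`-linear maps, which is
identified with `Hom(V, W) ⊗ A`. -/
instance : Category.{u} (VA k p) where
  Hom X Y := X.mod →ₗ[TruncPoly k p] Y.mod
  id X := LinearMap.id
  comp f g := g ∘ₗ f

instance : Preadditive (VA k p) where
  homGroup X Y := inferInstanceAs (AddCommGroup (X.mod →ₗ[TruncPoly k p] Y.mod))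
  add_comp _ _ _ f f' g := LinearMap.comp_add f f' g
  comp_add _ _ _ f g g' := LinearMap.add_comp f g' g

instance : Linear k (VA k p) where
  homModule X Y := inferInstanceAs (Module k (X.mod →ₗ[TruncPoly k p] Y.mod))
  smul_comp X Y Z c f g :=
    LinearMap.ext fun x => LinearMap.map_smul_of_tower (show Y.mod →ₗ[TruncPoly k p] Z.mod from g) c
      ((show X.mod →ₗ[TruncPoly k p] Y.mod from f) x)
  comp_smul _ _ _ f c g := LinearMap.smul_comp c g f

instance (X Y : VA k p) : Module.Finite k (X ⟶ Y) :=
  Module.Finite.of_injective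
    (LinearMap.restrictScalarsₗ k (TruncPoly k p) X.mod Y.mod k)
    (LinearMap.restrictScalars_injective k)

/-- The `A`-linear maps of degree `n`. -/
def homDeg (X Y : VA k p) (n : ℤ) : Submodule k (X ⟶ Y) where
  carrier := {f : X.mod →ₗ[TruncPoly k p] Y.mod | ∀ i, ∀ y ∈ X.deg i, f y ∈ Y.deg (i + n)}
  add_mem' hf hg i y hy := Submodule.add_mem _ (hf i y hy) (hg i y hy)
  zero_mem' _ _ _ := Submodule.zero_mem _
  smul_mem' c _ hf i y hy := Submodule.smul_mem _ c (hf i y hy)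

/-- Auxiliary: the projection of `Hom(V ⊗ A, W ⊗ A)` onto its part of degree `2 j`. -/
def homProj (X Y : VA k p) (j : Fin p) :
    (X.mod →ₗ[TruncPoly k p] Y.mod) →ₗ[k] (X.mod →ₗ[TruncPoly k p] Y.mod) where
  toFun f := (Y.proj j ∘ₗ f.restrictScalars k ∘ₗ TensorProduct.mk k _ _ 1).liftBaseChange _
  map_add' f g := by ext; simp
  map_smul' c f := by ext; simp

theorem homProj_tmul (X Y : VA k p) (j : Fin p) (f : X.mod →ₗ[TruncPoly k p] Y.mod)
    (a : TruncPoly k p) (v : X.space) :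
    homProj X Y j f (a ⊗ₜ v) = a • Y.proj j (f (1 ⊗ₜ v)) := by
  simp [homProj]

theorem one_tmul_mem (X : VA k p) (v : X.space) :
    (1 : TruncPoly k p) ⊗ₜ[k] v ∈ X.deg 0 :=
  Submodule.subset_span ⟨0, v, by simp, by simp⟩

theorem hom_ext' {X Y : VA k p} {f g : X.mod →ₗ[TruncPoly k p] Y.mod}
    (h : ∀ v : X.space, f (1 ⊗ₜ v) = g (1 ⊗ₜ v)) : f = g := by
  ext v
  exact h v

theorem pow_smul_mem (X : VA k p) (j : ℕ) {n : ℤ} {y : X.mod} (hy : y ∈ X.deg n) :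
    xA k p ^ j • y ∈ X.deg (2 * (j : ℤ) + n) := by
  induction hy using Submodule.span_induction with
  | zero => simp
  | add a b _ _ ha hb => rw [smul_add]; exact Submodule.add_mem _ ha hb
  | smul c a _ ha => rw [smul_comm]; exact Submodule.smul_mem _ _ ha
  | mem y hy =>
    obtain ⟨i, v, hi, rfl⟩ := hy
    rw [TensorProduct.smul_tmul', smul_eq_mul, ← pow_add]
    exact Submodule.subset_span ⟨j + i, v, by push_cast; linarith, rfl⟩

theorem homProj_mem (X Y : VA k p) (j : Fin p) (f : X.mod →ₗ[TruncPoly k p] Y.mod) :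
    homProj X Y j f ∈ homDeg X Y (2 * (j : ℤ)) := by
  intro i y hy
  induction hy using Submodule.span_induction with
  | zero => simp
  | add a b _ _ ha hb => rw [map_add]; exact Submodule.add_mem _ ha hb
  | smul c a _ ha => rw [LinearMap.map_smul_of_tower]; exact Submodule.smul_mem _ _ ha
  | mem y hy =>
    obtain ⟨l, v, rfl, rfl⟩ := hy
    rw [homProj_tmul]
    exact pow_smul_mem Y l (proj_mem Y j _)

theorem homDeg_eq_bot (X Y : VA k p) (n : ℤ) (hn : ∀ j : Fin p, n ≠ 2 * (j : ℤ)) :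
    homDeg X Y n = ⊥ := by
  rw [eq_bot_iff]
  intro (f : X.mod →ₗ[TruncPoly k p] Y.mod) hf
  refine hom_ext' (k := k) (p := p) (f := f) (g := 0) fun v => ?_
  have h : f (1 ⊗ₜ v) ∈ Y.deg n := by simpa using hf 0 _ (one_tmul_mem X v)
  have h2 := LinearMap.congr_fun (proj_sum Y) (f (1 ⊗ₜ v))
  rw [LinearMap.id_apply, LinearMap.sum_apply] at h2
  rw [← h2, LinearMap.zero_apply]
  exact Finset.sum_eq_zero fun j _ => proj_ne Y j (hn j) h

theorem homDeg_isInternal (X Y : VA k p) : DirectSum.IsInternal (homDeg X Y) := by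
  classical
  have same : ∀ (j : Fin p) (f : X.mod →ₗ[TruncPoly k p] Y.mod), f ∈ homDeg X Y (2 * (j : ℤ)) →
      homProj X Y j f = f := by
    intro j f hf
    refine hom_ext' fun v => ?_
    rw [homProj_tmul, one_smul, proj_same]
    simpa using hf 0 _ (one_tmul_mem X v)
  refine isInternal_of_projections _
    (fun n => if h : ∃ j : Fin p, n = 2 * (j : ℤ) then homProj X Y h.choose else 0) ?_ ?_ ?_
  · intro n f hf
    split_ifs with h
    · exact same _ _ (h.choose_spec ▸ hf)
    · push Not at h
      rw [homDeg_eq_bot X Y n h, Submodule.mem_bot] at hf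
      rw [hf]; rfl
  · intro m n hmn f hf
    split_ifs with h
    · refine hom_ext' (k := k) (p := p) (g := 0) fun v => ?_
      rw [homProj_tmul, one_smul, LinearMap.zero_apply]
      refine proj_ne Y _ (n := m) ?_ ?_
      · rw [← h.choose_spec]; exact hmn
      · simpa using hf 0 _ (one_tmul_mem X v)
    · rfl
  · rw [eq_top_iff]
    intro (f : X.mod →ₗ[TruncPoly k p] Y.mod) _
    have : f = ∑ j, homProj X Y j f := by
      refine hom_ext' (k := k) (p := p) fun v => ?_
      have h2 := LinearMap.congr_fun (proj_sum Y) (f (1 ⊗ₜ v))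
      rw [LinearMap.id_apply, LinearMap.sum_apply] at h2
      rw [LinearMap.sum_apply]
      simp only [homProj_tmul, one_smul]
      exact h2.symm
    rw [this]
    exact Submodule.sum_mem _ fun j _ => Submodule.mem_iSup_of_mem _ (homProj_mem X Y j f)

instance : GradedLinear k (VA k p) where
  homDeg := homDeg
  isInternal := homDeg_isInternal
  id_mem X i y hy := by rw [add_zero]; exact hy
  comp_mem hf hg i y hy := by rw [← add_assoc]; exact hg _ _ (hf i y hy)

end VA

/-- The forgetful functor `z : V_A ⥤ V`. -/
def zFun : VA k p ⥤ FGModuleCat.{u} k where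
  obj X := FGModuleCat.of k X.mod
  map {X Y} f := FGModuleCat.ofHom (LinearMap.restrictScalars k
    (show X.mod →ₗ[TruncPoly k p] Y.mod from f))

instance : (zFun k p).Additive where
instance : (zFun k p).Linear k where

/-- The induction functor `t : V ⥤ V_A`, `V ↦ V ⊗ A`. -/
def tFun : FGModuleCat.{u} k ⥤ VA k p where
  obj V := ⟨V⟩
  map f := LinearMap.baseChange (TruncPoly k p) f.hom.hom
  map_id _ := LinearMap.baseChange_id
  map_comp f g := LinearMap.baseChange_comp f.hom.hom g.hom.hom

instance : (tFun k p).Additive where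
  map_add {_ _ f g} := LinearMap.baseChange_add f.hom.hom g.hom.hom

instance : (tFun k p).Linear k where
  map_smul {_ _} f c := LinearMap.baseChange_smul c f.hom.hom

theorem tFun_isGraded : IsGradedFunctor k (tFun k p) where
  linear X Y := ((tFun k p).mapLinearMap k (X := X) (Y := Y)).isLinear
  map_mem {X Y n f} hf := by
    change f ∈ (if n = 0 then (⊤ : Submodule k (X ⟶ Y)) else ⊥) at hf
    split_ifs at hf with h
    · subst h
      intro i y hy
      rw [add_zero]
      induction hy using Submodule.span_induction with
      | zero => simp
      | add a b _ _ ha hb => rw [map_add]; exact Submodule.add_mem _ ha hb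
      | smul c a _ ha => rw [LinearMap.map_smul_of_tower]; exact Submodule.smul_mem _ _ ha
      | mem y hy =>
        obtain ⟨j, v, hj, rfl⟩ := hy
        exact Submodule.subset_span ⟨j, f.hom.hom v, hj, rfl⟩
    · rw [Submodule.mem_bot] at hf
      rw [hf, Functor.map_zero]
      exact Submodule.zero_mem _

end AffineCategory

namespace GrVect

variable {k : Type u} [Field k] {J : Type*} [Fintype J]

section

variable {M M' : Type*} [AddCommGroup M] [Module k M] [AddCommGroup M'] [Module k M']

/-- Given a graded space `M = ⨁ N n` and a decomposition `M = ⨁ j, E_j M` into graded subspaces,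
shift the degrees of `E_j M` by `wt j`: the new degree `n` part is `⨁ j, E_j (N (n - wt j))`. -/
def shiftDeg (N : ℤ → Submodule k M) (E : J → M →ₗ[k] M) (wt : J → ℤ) (n : ℤ) : Submodule k M :=
  ⨆ j, (N (n - wt j)).map (E j)

theorem shiftDeg_isInternal {N : ℤ → Submodule k M} (hN : DirectSum.IsInternal N)
    (E : J → M →ₗ[k] M) (wt : J → ℤ)
    (hdeg : ∀ j n, ∀ x ∈ N n, E j x ∈ N n) (hsum : ∑ j, E j = LinearMap.id)
    (hidem : ∀ j x, E j (E j x) = E j x) (horth : ∀ i j, i ≠ j → ∀ x, E i (E j x) = 0) :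
    DirectSum.IsInternal (shiftDeg N E wt) := by
  classical
  have key : ∀ n l j, ∀ y ∈ N (l - wt j),
      (∑ i, E i ∘ₗ gproj hN (n - wt i)) (E j y) = if n = l then E j y else 0 := by
    intro n l j y hy
    rw [LinearMap.sum_apply, Finset.sum_eq_single j]
    · rw [LinearMap.comp_apply]
      split_ifs with h
      · subst h
        rw [gproj_same hN (hdeg j _ y hy), hidem]
      · rw [gproj_ne hN (hdeg j _ y hy) (by lia), map_zero]
    · intro i _ hij
      rw [LinearMap.comp_apply, gproj_comm hN hN (E j) (hdeg j), horth i j hij]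
    · simp
  have key' : ∀ n l, ∀ x ∈ shiftDeg N E wt l,
      (∑ i, E i ∘ₗ gproj hN (n - wt i)) x = if n = l then x else 0 := by
    intro n l x hx
    unfold shiftDeg at hx
    induction hx using Submodule.iSup_induction' with
    | zero => simp
    | add a b _ _ ha hb => rw [map_add, ha, hb]; split_ifs <;> simp
    | mem j x hx =>
      obtain ⟨y, hy, rfl⟩ := hx
      exact key n l j y hy
  refine isInternal_of_projections _ (fun n => ∑ i, E i ∘ₗ gproj hN (n - wt i)) ?_ ?_ ?_
  · intro n x hx
    rw [key' n n x hx, if_pos rfl]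
  · intro m n hmn x hx
    rw [key' n m x hx, if_neg (Ne.symm hmn)]
  · rw [eq_top_iff]
    intro x _
    have hx := LinearMap.congr_fun hsum x
    rw [LinearMap.id_apply, LinearMap.sum_apply] at hx
    rw [← hx]
    refine Submodule.sum_mem _ fun j _ => ?_
    obtain ⟨s, hs⟩ := exists_sum_gproj hN x
    rw [hs, map_sum]
    refine Submodule.sum_mem _ fun n _ => ?_
    refine Submodule.mem_iSup_of_mem (n + wt j) (Submodule.mem_iSup_of_mem j ?_)
    refine Submodule.mem_map_of_mem ?_
    rw [add_sub_cancel_right]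
    exact gproj_mem _ _ _

/-- Morphisms of graded spaces remain such after shifting degrees. -/
theorem shiftDeg_mapGr {N : ℤ → Submodule k M} {N' : ℤ → Submodule k M'}
    {E : J → M →ₗ[k] M} {E' : J → M' →ₗ[k] M'} (wt wt' : J → ℤ)
    (hdeg : ∀ j n, ∀ x ∈ N n, E j x ∈ N n) (hsum : ∑ j, E j = LinearMap.id)
    (hidem : ∀ j x, E j (E j x) = E j x) (horth : ∀ i j, i ≠ j → ∀ x, E i (E j x) = 0)
    (hsum' : ∑ j, E' j = LinearMap.id) {f : M →ₗ[k] M'} (hf : f ∈ mapGr N N') :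
    f ∈ mapGr (shiftDeg N E wt) (shiftDeg N' E' wt') := by
  classical
  unfold mapGr at hf
  induction hf using Submodule.iSup_induction' with
  | zero => exact Submodule.zero_mem _
  | add a b _ _ ha hb => exact Submodule.add_mem _ ha hb
  | mem n f hf =>
    have : f = ∑ i, ∑ j, (E' j ∘ₗ f ∘ₗ E i) := by
      refine LinearMap.ext fun x => ?_
      have hx := LinearMap.congr_fun hsum x
      rw [LinearMap.id_apply, LinearMap.sum_apply] at hx
      rw [LinearMap.sum_apply]
      conv_lhs => rw [← hx, map_sum]
      refine Finset.sum_congr rfl fun i _ => ?_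
      have hy := LinearMap.congr_fun hsum' (f (E i x))
      rw [LinearMap.id_apply, LinearMap.sum_apply] at hy
      rw [LinearMap.sum_apply, ← hy]
      rfl
    rw [this]
    refine Submodule.sum_mem _ fun i _ => Submodule.sum_mem _ fun j _ => ?_
    refine Submodule.mem_iSup_of_mem (n + wt' j - wt i) fun l x hx => ?_
    unfold shiftDeg at hx
    induction hx using Submodule.iSup_induction' with
    | zero => simp
    | add a b _ _ ha hb => rw [map_add]; exact Submodule.add_mem _ ha hb
    | mem i' x hx =>
      obtain ⟨y, hy, rfl⟩ := hx
      rw [LinearMap.comp_apply, LinearMap.comp_apply]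
      by_cases h : i = i'
      · subst h
        rw [hidem]
        refine Submodule.mem_iSup_of_mem j (Submodule.mem_map_of_mem ?_)
        have := hf _ _ (hdeg i _ y hy)
        rwa [show l + (n + wt' j - wt i) - wt' j = l - wt i + n by ring]
      · rw [horth i i' h]
        simp

end

/-- The graded space with the same underlying space as `M` and shifted degrees. -/
abbrev regrade (M : GrVect k) (E : J → M.carrier →ₗ[k] M.carrier) (wt : J → ℤ)
    (hdeg : ∀ j n, ∀ x ∈ M.deg n, E j x ∈ M.deg n) (hsum : ∑ j, E j = LinearMap.id)
    (hidem : ∀ j x, E j (E j x) = E j x) (horth : ∀ i j, i ≠ j → ∀ x, E i (E j x) = 0) :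
    GrVect k where
  carrier := M.carrier
  deg := shiftDeg M.deg E wt
  isInternal := shiftDeg_isInternal M.isInternal E wt hdeg hsum hidem horth
  finite n := by
    have := M.finite
    unfold shiftDeg
    infer_instance
  bddBelow := by
    obtain ⟨b, hb⟩ := M.bddBelow
    obtain ⟨c, hc⟩ := (Set.finite_range wt).bddBelow
    refine ⟨b + c, fun n hn => ?_⟩
    rw [eq_bot_iff]
    refine iSup_le fun j => ?_
    have := hc ⟨j, rfl⟩
    rw [hb _ (by lia), Submodule.map_bot]

end GrVect

section Main

variable (k : Type u) [Field k] (p d : ℕ)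

/-- The category `P_d^{f+}` of graded bounded below strict polynomial functors of degree `d`: the
`k`-linear functors `Γ^d V ⥤ V^{f+}` sending all morphisms to maps of degree `0`. Morphisms are
natural transformations with components of arbitrary degrees. -/
abbrev PolyFun := GrFun k (GammaCat k d (FGModuleCat.{u} k))

/-- The category `P_d^{af}` of affine strict polynomial functors homogeneous of degree `d`: the graded
`k`-linear functors `Γ^d V_A ⥤ V^{f+}`. -/
abbrev AffPolyFun := GrFun k (GammaCat k d (VA k p))

/-- `t^*`: precomposition with `t : Γ^d V ⥤ Γ^d V_A`. -/
def tStar : AffPolyFun k p d ⥤ PolyFun k d :=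
  precomp (GammaCat.mapFunctor k d (tFun k p))
    (GammaCat.mapFunctor_isGraded (tFun k p) (tFun_isGraded k p))

variable {k p d}

/-- The projection of `z(V ⊗ A) = ⨁ j, V ⊗ x^j` onto its `j`-th summand, as a morphism of `V`. -/
def zProj (X : VA k p) (j : Fin p) : (zFun k p).obj X ⟶ (zFun k p).obj X :=
  FGModuleCat.ofHom (X.proj j)

theorem zProj_sum (X : VA k p) : ∑ j, zProj X j = 𝟙 _ := by
  let φ : ((zFun k p).obj X ⟶ (zFun k p).obj X) →+ (X.mod →ₗ[k] X.mod) :=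
    { toFun f := f.hom.hom
      map_zero' := rfl
      map_add' _ _ := rfl }
  apply FGModuleCat.hom_ext
  exact (map_sum φ (zProj X) Finset.univ).trans X.proj_sum

theorem zProj_idem (X : VA k p) (j : Fin p) : zProj X j ≫ zProj X j = zProj X j := by
  apply FGModuleCat.hom_ext
  refine LinearMap.ext fun y => ?_
  exact X.proj_same j (X.proj_mem j y)

theorem zProj_orth (X : VA k p) (i j : Fin p) (h : i ≠ j) : zProj X i ≫ zProj X j = 0 := by
  apply FGModuleCat.hom_ext
  refine LinearMap.ext fun y => ?_
  exact X.proj_ne j (by have := Fin.val_ne_of_ne h; lia) (X.proj_mem i y)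

/-- The idempotent `e_γ ∈ Γ^d(End(V ⊗ A))` for the decomposition `V ⊗ A = ⨁ j, V ⊗ x^j`; for a
strict polynomial functor `F`, the subspace `F(V ⊗ A)_γ` is the image of `F(e_γ)`. -/
def zIdem (X : GammaCat k d (VA k p)) (γ : GammaCat.MultiIndex (Fin p) d) :
    (GammaCat.mapFunctor k d (zFun k p)).obj X ⟶ (GammaCat.mapFunctor k d (zFun k p)).obj X :=
  GammaCat.weightIdem ((zFun k p).obj X.obj) (zProj X.obj) γ.1

/-- The degree `∑ j, γ_j * deg(x^j) = ∑ j, γ_j * 2 j` of `F(V ⊗ A)_γ`, for `F` of degree `0`. -/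
def zWeight (γ : GammaCat.MultiIndex (Fin p) d) : ℤ :=
  ∑ j, (γ.1 j : ℤ) * (2 * (j : ℤ))

theorem zIdem_comp (X : GammaCat k d (VA k p)) (γ γ' : GammaCat.MultiIndex (Fin p) d) :
    zIdem X γ ≫ zIdem X γ' = if γ = γ' then zIdem X γ else 0 := by
  have := GammaCat.weightIdem_comp (k := k) (d := d) ((zFun k p).obj X.obj) (zProj X.obj)
    (zProj_idem X.obj) (zProj_orth X.obj) γ.1 γ'.1
  by_cases h : γ = γ'
  · rw [if_pos h]
    rw [if_pos (congrArg Subtype.val h)] at this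
    exact this
  · rw [if_neg h]
    rw [if_neg (fun h' => h (Subtype.ext h'))] at this
    exact this

theorem zIdem_sum (X : GammaCat k d (VA k p)) : ∑ γ, zIdem X γ = 𝟙 _ :=
  GammaCat.weightIdem_sum _ _ (zProj_sum X.obj)

/-- A functor `F ∈ P_d^{f+}` maps every morphism to a linear map of degree `0`. -/
theorem PolyFun.map_deg (F : PolyFun k d) {V W : GammaCat k d (FGModuleCat.{u} k)} (f : V ⟶ W) :
    (F.obj.map f).1 ∈ GrVect.linDeg (F.obj.obj V) (F.obj.obj W) 0 := by
  refine F.property.map_mem (n := 0) ?_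
  change f.1 ∈ tensorDeg d _ 0
  generalize f.1 = f
  induction f using PiTensorProduct.induction_on with
  | add a b ha hb => exact Submodule.add_mem _ ha hb
  | smul_tprod c x =>
    refine Submodule.smul_mem _ _ (Submodule.subset_span ⟨fun _ => 0, x, fun i => ?_, by simp, rfl⟩)
    change x i ∈ (if (0 : ℤ) = 0 then (⊤ : Submodule k (V.obj ⟶ W.obj)) else ⊥)
    simp

section

variable (F : PolyFun k d) (X : GammaCat k d (VA k p))

/-- The action of `e_γ` on the space `F(V ⊗ A)`. -/
abbrev zAct (γ : GammaCat.MultiIndex (Fin p) d) :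
    (F.obj.obj ((GammaCat.mapFunctor k d (zFun k p)).obj X)).carrier →ₗ[k]
      (F.obj.obj ((GammaCat.mapFunctor k d (zFun k p)).obj X)).carrier :=
  (F.obj.map (zIdem X γ)).1

theorem zAct_deg (γ : GammaCat.MultiIndex (Fin p) d) (n : ℤ) (x)
    (hx : x ∈ (F.obj.obj ((GammaCat.mapFunctor k d (zFun k p)).obj X)).deg n) :
    zAct F X γ x ∈ (F.obj.obj ((GammaCat.mapFunctor k d (zFun k p)).obj X)).deg n := by
  simpa using PolyFun.map_deg F (zIdem X γ) n x hx

theorem zAct_sum : ∑ γ, zAct F X γ = LinearMap.id := by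
  have h := map_sum (IsLinearMap.mk' _ (F.property.linear _ _)) (zIdem X) Finset.univ
  rw [zIdem_sum] at h
  have h2 := h.symm.trans (F.obj.map_id _)
  exact (map_sum (GrVect.gradedHom _ _).subtype
    (fun γ => F.obj.map (zIdem X γ)) Finset.univ).symm.trans (congrArg Subtype.val h2)

theorem zAct_idem (γ : GammaCat.MultiIndex (Fin p) d) (x) :
    zAct F X γ (zAct F X γ x) = zAct F X γ x := by
  have h := F.obj.map_comp (zIdem X γ) (zIdem X γ)
  rw [zIdem_comp, if_pos rfl] at h
  exact (LinearMap.congr_fun (congrArg Subtype.val h) x).symm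

theorem zAct_orth (γ γ' : GammaCat.MultiIndex (Fin p) d) (hne : γ ≠ γ') (x) :
    zAct F X γ (zAct F X γ' x) = 0 := by
  have h := F.obj.map_comp (zIdem X γ') (zIdem X γ)
  rw [zIdem_comp, if_neg hne.symm, (F.property.linear _ _).map_zero] at h
  exact (LinearMap.congr_fun (congrArg Subtype.val h) x).symm

/-- The graded space `z^*(F)(V ⊗ A)`: the space `F(V ⊗ A)`, with `F^s(V ⊗ A)_γ` in degree
`s + ∑ j, γ_j * 2 j`. -/
abbrev zStarObj : GrVect k :=
  (F.obj.obj ((GammaCat.mapFunctor k d (zFun k p)).obj X)).regrade (zAct F X) zWeight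
    (zAct_deg F X) (zAct_sum F X) (zAct_idem F X) (zAct_orth F X)

end

theorem zStar_map_mem (F : PolyFun k d) {X Y : GammaCat k d (VA k p)} {n : ℤ} {f : X ⟶ Y}
    (hf : f ∈ GradedLinear.homDeg (k := k) X Y n) :
    (F.obj.map ((GammaCat.mapFunctor k d (zFun k p)).map f)).1 ∈
      GrVect.mapDeg (GrVect.shiftDeg (GrVect.deg _) (zAct F X) zWeight)
        (GrVect.shiftDeg (GrVect.deg _) (zAct F Y) zWeight) n := by
  intro l x hx
  unfold GrVect.shiftDeg at hx
  induction hx using Submodule.iSup_induction' with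
  | zero => rw [LinearMap.map_zero]; exact Submodule.zero_mem _
  | add a b _ _ ha hb => rw [map_add]; exact Submodule.add_mem _ ha hb
  | mem γ x hx =>
    obtain ⟨y, hy, rfl⟩ := hx
    set g := (GammaCat.mapFunctor k d (zFun k p)).map f with hg
    have h1 : (F.obj.map g).1 ((F.obj.map (zIdem X γ)).1 y) =
        (F.obj.map (zIdem X γ ≫ g)).1 y := by rw [F.obj.map_comp]; rfl
    have h2 : zIdem X γ ≫ g = ∑ γ', zIdem X γ ≫ g ≫ zIdem Y γ' := by
      rw [← Preadditive.comp_sum, ← Preadditive.comp_sum, zIdem_sum, Category.comp_id]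
    have h3 : F.obj.map (zIdem X γ ≫ g) = ∑ γ', F.obj.map (zIdem X γ ≫ g ≫ zIdem Y γ') := by
      conv_lhs => rw [h2]
      exact map_sum (IsLinearMap.mk' _ (F.property.linear _ _)) _ _
    have h4 : (F.obj.map (zIdem X γ ≫ g)).1 y =
        ∑ γ', (F.obj.map (zIdem X γ ≫ g ≫ zIdem Y γ')).1 y := by
      rw [h3]
      refine (LinearMap.congr_fun (map_sum (GrVect.gradedHom _ _).subtype
        (fun γ' => F.obj.map (zIdem X γ ≫ g ≫ zIdem Y γ')) Finset.univ) y).trans ?_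
      exact LinearMap.sum_apply _ _ _
    rw [h1, h4]
    refine Submodule.sum_mem _ fun γ' _ => ?_
    by_cases hw : zWeight γ' = zWeight γ + n
    · refine Submodule.mem_iSup_of_mem γ' ⟨(F.obj.map (zIdem X γ ≫ g)).1 y, ?_, ?_⟩
      · have := PolyFun.map_deg F (zIdem X γ ≫ g) _ y hy
        rw [show l + n - zWeight γ' = l - zWeight γ + 0 by lia]
        exact this
      · rw [← Category.assoc, F.obj.map_comp (zIdem X γ ≫ g)]
        rfl
    · have : zIdem X γ ≫ g ≫ zIdem Y γ' = 0 := by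
        refine GammaCat.weightIdem_comp_comp (zProj X.obj) (zProj Y.obj) (fun j => 2 * (j : ℤ))
          (fun n => (GradedLinear.homDeg (k := k) X.obj Y.obj n).map
            ((zFun k p).mapLinearMap k)) ?_ n g ?_ γ.1 γ'.1 hw
        · rintro n _ ⟨f, hf, rfl⟩ i j hij
          apply FGModuleCat.hom_ext
          refine LinearMap.ext fun y => ?_
          exact Y.obj.proj_ne j (Ne.symm hij) (hf _ _ (X.obj.proj_mem i y))
        · rw [hg, GammaCat.mapFunctor_val]
          have hf' : f.1 ∈ tensorDeg d _ n := hf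
          generalize f.1 = f at hf'
          induction hf' using Submodule.span_induction with
          | zero => simp
          | add x y _ _ hx hy => rw [map_add]; exact Submodule.add_mem _ hx hy
          | smul c x _ hx => rw [map_smul]; exact Submodule.smul_mem _ _ hx
          | mem f hf =>
            obtain ⟨a, x, hx, ha, rfl⟩ := hf
            rw [PiTensorProduct.map_tprod]
            exact Submodule.subset_span
              ⟨a, _, fun i => Submodule.mem_map_of_mem (hx i), ha, rfl⟩
      rw [this, (F.property.linear _ _).map_zero]
      exact Submodule.zero_mem _

theorem zStarMap_mem (F : PolyFun k d) {X Y : GammaCat k d (VA k p)} (f : X ⟶ Y) :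
    (F.obj.map ((GammaCat.mapFunctor k d (zFun k p)).map f)).1 ∈
      GrVect.mapGr (GrVect.shiftDeg (GrVect.deg _) (zAct F X) zWeight)
        (GrVect.shiftDeg (GrVect.deg _) (zAct F Y) zWeight) := by
  have h := (F.obj.map ((GammaCat.mapFunctor k d (zFun k p)).map f)).2
  refine GrVect.shiftDeg_mapGr _ _ ?_ ?_ ?_ ?_ ?_ h
  · exact zAct_deg F X
  · exact zAct_sum F X
  · exact zAct_idem F X
  · exact zAct_orth F X
  · exact zAct_sum F Y

/-- `z^*(F)` on morphisms. -/
def zStarMap (F : PolyFun k d) {X Y : GammaCat k d (VA k p)} (f : X ⟶ Y) :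
    zStarObj F X ⟶ zStarObj F Y :=
  ⟨(F.obj.map ((GammaCat.mapFunctor k d (zFun k p)).map f)).1, zStarMap_mem F f⟩

theorem zStarMap_val (F : PolyFun k d) {X Y : GammaCat k d (VA k p)} (f : X ⟶ Y) :
    (zStarMap F f).1 = (F.obj.map ((GammaCat.mapFunctor k d (zFun k p)).map f)).1 := by
  unfold zStarMap
  rfl

theorem zStarMap_id (F : PolyFun k d) (X : GammaCat k d (VA k p)) :
    zStarMap F (𝟙 X) = 𝟙 (zStarObj F X) := by
  apply GrVect.hom_ext
  rw [zStarMap_val, CategoryTheory.Functor.map_id, CategoryTheory.Functor.map_id, GrVect.id_val,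
    GrVect.id_val]

theorem zStarMap_comp (F : PolyFun k d) {X Y Z : GammaCat k d (VA k p)} (f : X ⟶ Y) (g : Y ⟶ Z) :
    zStarMap F (f ≫ g) = zStarMap F f ≫ zStarMap F g := by
  apply GrVect.hom_ext
  rw [zStarMap_val, CategoryTheory.Functor.map_comp, CategoryTheory.Functor.map_comp,
    GrVect.comp_val, GrVect.comp_val, zStarMap_val, zStarMap_val]

theorem zStarMap_linear (F : PolyFun k d) (X Y : GammaCat k d (VA k p)) :
    IsLinearMap k (zStarMap F : (X ⟶ Y) → (zStarObj F X ⟶ zStarObj F Y)) where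
  map_add f g := by
    apply GrVect.hom_ext
    rw [zStarMap_val, (GammaCat.mapFunctor_linear _ _ _).map_add, (F.property.linear _ _).map_add,
      GrVect.add_val, GrVect.add_val, zStarMap_val, zStarMap_val]
  map_smul c f := by
    apply GrVect.hom_ext
    rw [zStarMap_val, (GammaCat.mapFunctor_linear _ _ _).map_smul, (F.property.linear _ _).map_smul,
      GrVect.smul_val, GrVect.smul_val, zStarMap_val]

/-- `z^*(F)`, i.e. `F ∘ z` with the above grading on its values. -/
def zStarFun (F : PolyFun k d) : AffPolyFun k p d where
  obj :=
    { obj := zStarObj F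
      map := zStarMap F
      map_id := zStarMap_id F
      map_comp := zStarMap_comp F }
  property :=
    { linear := zStarMap_linear F
      map_mem hf := zStar_map_mem F hf }

theorem zStarApp_mem {F G : PolyFun k d} (φ : F ⟶ G) (X : GammaCat k d (VA k p)) :
    (φ.hom.app ((GammaCat.mapFunctor k d (zFun k p)).obj X)).1 ∈
      GrVect.mapGr (GrVect.shiftDeg (GrVect.deg _) (zAct F X) zWeight)
        (GrVect.shiftDeg (GrVect.deg _) (zAct G X) zWeight) := by
  have h := (φ.hom.app ((GammaCat.mapFunctor k d (zFun k p)).obj X)).2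
  refine GrVect.shiftDeg_mapGr _ _ ?_ ?_ ?_ ?_ ?_ h
  · exact zAct_deg F X
  · exact zAct_sum F X
  · exact zAct_idem F X
  · exact zAct_orth F X
  · exact zAct_sum G X

/-- The component of `z^*(φ)` at `V ⊗ A` is the component of `φ` at `z(V ⊗ A)`. -/
def zStarApp {F G : PolyFun k d} (φ : F ⟶ G) (X : GammaCat k d (VA k p)) :
    zStarObj F X ⟶ zStarObj G X :=
  ⟨(φ.hom.app ((GammaCat.mapFunctor k d (zFun k p)).obj X)).1, zStarApp_mem φ X⟩

theorem zStarApp_val {F G : PolyFun k d} (φ : F ⟶ G) (X : GammaCat k d (VA k p)) :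
    (zStarApp φ X).1 = (φ.hom.app ((GammaCat.mapFunctor k d (zFun k p)).obj X)).1 := by
  unfold zStarApp
  rfl

theorem zStarApp_naturality {F G : PolyFun k d} (φ : F ⟶ G) {X Y : GammaCat k d (VA k p)}
    (f : X ⟶ Y) : zStarMap F f ≫ zStarApp φ Y = zStarApp φ X ≫ zStarMap G f := by
  apply GrVect.hom_ext
  rw [GrVect.comp_val, GrVect.comp_val, zStarMap_val, zStarMap_val, zStarApp_val, zStarApp_val,
    ← GrVect.comp_val, ← GrVect.comp_val, φ.hom.naturality]

theorem zStarApp_id (F : PolyFun k d) (X : GammaCat k d (VA k p)) :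
    zStarApp (𝟙 F) X = 𝟙 (zStarObj F X) := by
  apply GrVect.hom_ext
  rw [zStarApp_val, GrVect.id_val]
  rfl

theorem zStarApp_comp {F G H : PolyFun k d} (φ : F ⟶ G) (ψ : G ⟶ H) (X : GammaCat k d (VA k p)) :
    zStarApp (φ ≫ ψ) X = zStarApp φ X ≫ zStarApp ψ X := by
  apply GrVect.hom_ext
  rw [zStarApp_val, GrVect.comp_val, zStarApp_val, zStarApp_val]
  rfl

variable (k p d) in
/-- The scalar extension functor `z^* : P_d^{f+} ⥤ P_d^{af}`. -/
def zStar : PolyFun k d ⥤ AffPolyFun k p d where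
  obj F := zStarFun F
  map φ := ObjectProperty.homMk
    { app := zStarApp φ
      naturality _ _ f := zStarApp_naturality φ f }
  map_id F := by
    apply ObjectProperty.hom_ext
    apply NatTrans.ext
    exact funext (zStarApp_id F)
  map_comp φ ψ := by
    apply ObjectProperty.hom_ext
    apply NatTrans.ext
    exact funext (zStarApp_comp φ ψ)

end Main

end AffineSPF

end

/-!
The adjunction `z^* ⊣ t^*` is induced by a more elementary one. Since `Hom_A(V ⊗ A, M)` is
`Hom(V, M)`, induction `t : V ⥤ V_A` is left adjoint to the forgetful functor `z : V_A ⥤ V`. The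
unit `η` and counit `ε` of this adjunction pass to `d`-th divided powers as `η ⊗ ⋯ ⊗ η` and
`ε ⊗ ⋯ ⊗ ε`, so `Γ^d t ⊣ Γ^d z` (`GammaCat.mapAdjunction`). Precomposition exchanges the roles of
the adjoints: `F ⟶ F ∘ z ∘ t` given by `F(η)` and `G ∘ t ∘ z ⟶ G` given by `G(ε)` are the unit and
counit of `z^* ⊣ t^*` (`starAdjunction`).

What remains concerns degrees. The unit `v ↦ 1 ⊗ v` takes values in `V ⊗ x^0`, hence it is killed by
all `e_γ` of nonzero weight (`unit_comp_zIdem`), and `F(η)` has degree `0`. The counit is the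
multiplication `A ⊗ (A ⊗ V) → A ⊗ V`; on `A ⊗ (V ⊗ x^j)` it has degree `2 j`, hence `t(e_γ) ≫ ε`
has degree `∑ j, γ_j * 2 j` (`map_zIdem_comp_counit_mem`). This is exactly the shift in the
definition of `z^*`, so `G(ε)` has degree `0`. With unit and counit of degree `0`, both the
bijection of Hom spaces and its inverse preserve degrees.

The isomorphism `z^*(Γ^{d,U}) ≅ h^{U ⊗ A}` is the bijection `Hom(U, z X) ≅ Hom(t U, X)` of the
adjunction `Γ^d t ⊣ Γ^d z`, which sends `f` to `t(f) ≫ ε`. By the same computation it has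
degree `0`, and then so does its inverse.
-/

noncomputable section

namespace AffineSPF

/-! ### Divided powers of adjunctions -/

namespace GammaCat

variable {k : Type u} [Field k] {d : ℕ}
variable {C : Type*} [Category* C] [Preadditive C] [Linear k C]
variable {D : Type*} [Category* D] [Preadditive D] [Linear k D]

variable (k) in
/-- The morphism `f ⊗ ⋯ ⊗ f` of `Γ^d C`. -/
def powHom {X Y : GammaCat k d C}
    (f : X.obj ⟶ Y.obj) : X ⟶ Y :=
  symPow k d f

theorem powHom_val {X Y : GammaCat k d C} (f : X.obj ⟶ Y.obj) :
    (powHom k f).1 = PiTensorProduct.tprod k fun _ => f := rfl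

theorem powHom_comp {X Y Z : GammaCat k d C} (f : X.obj ⟶ Y.obj) (g : Y.obj ⟶ Z.obj) :
    powHom k f ≫ powHom k g = powHom k (X := X) (Y := Z) (f ≫ g) := by
  apply Subtype.ext
  rw [comp_val, powHom_val, powHom_val, powHom_val, PiTensorProduct.map₂_tprod_tprod]
  rfl

theorem mapFunctor_powHom (F : C ⥤ D) [F.Additive] [F.Linear k] {X Y : GammaCat k d C}
    (f : X.obj ⟶ Y.obj) :
    (mapFunctor k d F).map (powHom k f) =
      powHom k (X := (mapFunctor k d F).obj X) (Y := (mapFunctor k d F).obj Y) (F.map f) := by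
  apply Subtype.ext
  rw [mapFunctor_val, powHom_val]
  exact PiTensorProduct.map_tprod _ _

variable (k d) in
/-- The natural transformation `Γ^d F ⟶ Γ^d G` whose components are the `d`-th tensor powers of
those of a natural transformation `F ⟶ G`. -/
def mapNatTrans {F G : C ⥤ D} [F.Additive] [F.Linear k] [G.Additive] [G.Linear k]
    (τ : F ⟶ G) : mapFunctor k d F ⟶ mapFunctor k d G where
  app X := powHom k (X := (mapFunctor k d F).obj X) (Y := (mapFunctor k d G).obj X) (τ.app X.obj)
  naturality X Y f := by
    apply Subtype.ext
    change PiTensorProduct.map₂ (fun _ => compBilin k _ _ _)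
        (PiTensorProduct.map (fun _ => F.mapLinearMap k) f.1)
        (PiTensorProduct.tprod k fun _ => τ.app Y.obj) =
      PiTensorProduct.map₂ (fun _ => compBilin k _ _ _)
        (PiTensorProduct.tprod k fun _ => τ.app X.obj)
        (PiTensorProduct.map (fun _ => G.mapLinearMap k) f.1)
    generalize f.1 = f
    induction f using PiTensorProduct.induction_on with
    | add x y hx hy => simp only [map_add, LinearMap.add_apply, hx, hy]
    | smul_tprod c x =>
      simp [PiTensorProduct.map₂_tprod_tprod, compBilin, PiTensorProduct.map_tprod]

variable (k d) in
/-- An adjunction between `k`-linear categories induces one between their `d`-th divided powers,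
with unit and counit the `d`-th tensor powers of those of the given adjunction. -/
def mapAdjunction {L : C ⥤ D} {R : D ⥤ C} [L.Additive] [L.Linear k] [R.Additive] [R.Linear k]
    (adj : L ⊣ R) : mapFunctor k d L ⊣ mapFunctor k d R where
  unit :=
    { app X := powHom k (Y := (mapFunctor k d R).obj ((mapFunctor k d L).obj X))
        (adj.unit.app X.obj)
      naturality X Y f := by
        have h := (mapNatTrans k d adj.unit).naturality f
        refine Eq.trans ?_ (h.trans ?_)
        · refine congrArg (· ≫ (mapNatTrans k d adj.unit).app Y) (Subtype.ext ?_)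
          change f.1 = PiTensorProduct.map (fun _ => (𝟭 C).mapLinearMap k) f.1
          exact (LinearMap.congr_fun PiTensorProduct.map_id f.1).symm
        · refine congrArg ((mapNatTrans k d adj.unit).app X ≫ ·) (Subtype.ext ?_)
          change PiTensorProduct.map (fun _ => (L ⋙ R).mapLinearMap k) f.1 =
            PiTensorProduct.map (fun _ => R.mapLinearMap k)
              (PiTensorProduct.map (fun _ => L.mapLinearMap k) f.1)
          exact LinearMap.congr_fun (PiTensorProduct.map_comp
            (fun _ => R.mapLinearMap k) (fun _ => L.mapLinearMap k)) f.1 }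
  counit :=
    { app X := powHom k (X := (mapFunctor k d L).obj ((mapFunctor k d R).obj X))
        (adj.counit.app X.obj)
      naturality X Y f := by
        have h := (mapNatTrans k d adj.counit).naturality f
        refine Eq.trans ?_ (h.trans ?_)
        · refine congrArg (· ≫ (mapNatTrans k d adj.counit).app Y) (Subtype.ext ?_)
          change PiTensorProduct.map (fun _ => L.mapLinearMap k)
              (PiTensorProduct.map (fun _ => R.mapLinearMap k) f.1) =
            PiTensorProduct.map (fun _ => (R ⋙ L).mapLinearMap k) f.1
          exact (LinearMap.congr_fun (PiTensorProduct.map_comp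
            (fun _ => L.mapLinearMap k) (fun _ => R.mapLinearMap k)) f.1).symm
        · refine congrArg ((mapNatTrans k d adj.counit).app X ≫ ·) (Subtype.ext ?_)
          change PiTensorProduct.map (fun _ => (𝟭 D).mapLinearMap k) f.1 = f.1
          exact LinearMap.congr_fun PiTensorProduct.map_id f.1 }
  left_triangle_components X :=
    (congrArg (· ≫ _) (mapFunctor_powHom L _)).trans ((powHom_comp _ _).trans
      (congrArg (powHom k (X := (mapFunctor k d L).obj X) (Y := (mapFunctor k d L).obj X))
        (adj.left_triangle_components X.obj)))
  right_triangle_components X :=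
    (congrArg (_ ≫ ·) (mapFunctor_powHom R _)).trans ((powHom_comp _ _).trans
      (congrArg (powHom k (X := (mapFunctor k d R).obj X) (Y := (mapFunctor k d R).obj X))
        (adj.right_triangle_components X.obj)))

end GammaCat

/-! ### The adjunction between induction and restriction -/

namespace VA

variable (k : Type u) [Field k] (p : ℕ)

/-- Extension of scalars is left adjoint to restriction of scalars: the unit is `v ↦ 1 ⊗ v` and the
counit is the multiplication `A ⊗ (A ⊗ V) → A ⊗ V`. -/
def tzAdjunction : tFun k p ⊣ zFun k p where
  unit :=
    { app V := FGModuleCat.ofHom (TensorProduct.mk k (TruncPoly k p) V 1)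
      naturality V W f := by
        apply FGModuleCat.hom_ext
        refine LinearMap.ext fun v => ?_
        exact (LinearMap.baseChange_tmul (A := TruncPoly k p) (f := f.hom.hom) 1 v).symm }
  counit :=
    { app X := (LinearMap.id : X.mod →ₗ[k] X.mod).liftBaseChange (TruncPoly k p)
      naturality X Y (f : X.mod →ₗ[TruncPoly k p] Y.mod) := by
        refine hom_ext' (X := (tFun k p).obj ((zFun k p).obj X)) fun (y : X.mod) => ?_
        change LinearMap.liftBaseChange (TruncPoly k p) (LinearMap.id : Y.mod →ₗ[k] Y.mod)
            (LinearMap.baseChange (TruncPoly k p) (f.restrictScalars k) (1 ⊗ₜ (y : X.mod))) =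
          f (LinearMap.liftBaseChange (TruncPoly k p) (LinearMap.id : X.mod →ₗ[k] X.mod)
            (1 ⊗ₜ (y : X.mod)))
        simp }
  left_triangle_components V := by
    refine hom_ext' (X := (tFun k p).obj V) fun (v : V) => ?_
    change LinearMap.liftBaseChange (TruncPoly k p)
        (LinearMap.id : (TruncPoly k p ⊗[k] V) →ₗ[k] (TruncPoly k p ⊗[k] V))
        (LinearMap.baseChange (TruncPoly k p) (TensorProduct.mk k (TruncPoly k p) V 1)
          (1 ⊗ₜ v)) = 1 ⊗ₜ v
    simp
  right_triangle_components X := by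
    apply FGModuleCat.hom_ext
    refine LinearMap.ext fun (y : X.mod) => ?_
    change LinearMap.liftBaseChange (TruncPoly k p) (LinearMap.id : X.mod →ₗ[k] X.mod)
      (1 ⊗ₜ y) = y
    simp

end VA

/-! ### Degrees of the unit and the counit -/

theorem GrVect.map_mem_of_mem_shiftDeg {k : Type u} [Field k] {J : Type*} {M M' : Type*}
    [AddCommGroup M] [Module k M] [AddCommGroup M'] [Module k M'] {N : ℤ → Submodule k M}
    {E : J → M →ₗ[k] M} {wt : J → ℤ} {l : ℤ} (f : M →ₗ[k] M') (S : Submodule k M')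
    (h : ∀ j, ∀ y ∈ N (l - wt j), f (E j y) ∈ S) {x : M} (hx : x ∈ shiftDeg N E wt l) :
    f x ∈ S :=
  (iSup_le fun j => Submodule.map_le_iff_le_comap.2 fun y hy => h j y hy :
    shiftDeg N E wt l ≤ S.comap f) hx

/-- The linear map `f` sends a weight tensor into `S` as soon as it does so for every summand
`π_{s 1} ⊗ ⋯ ⊗ π_{s d}`. -/
theorem GammaCat.map_weightTensor_mem {k : Type u} [Field k] {d : ℕ} {J : Type*} [Fintype J]
    [DecidableEq J] {X M : Type*} [AddCommGroup X] [Module k X] [AddCommGroup M] [Module k M]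
    (π : J → X) (γ : J → ℕ) (f : (⨂[k] _ : Fin d, X) →ₗ[k] M) (S : Submodule k M)
    (h : ∀ s : Fin d → J, (∀ wt : J → ℤ, ∑ i, wt (s i) = ∑ j, (γ j : ℤ) * wt j) →
      f (PiTensorProduct.tprod k fun i => π (s i)) ∈ S) :
    f (weightTensor π γ) ∈ S := by
  unfold weightTensor
  rw [map_sum]
  exact Submodule.sum_mem _ fun s hs => h s (weight_sum s γ (Finset.mem_filter.1 hs).2)

section

variable (k : Type u) [Field k] (p d : ℕ)

/-- The adjunction `Γ^d t ⊣ Γ^d z`. -/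
abbrev gammaAdj : GammaCat.mapFunctor k d (tFun k p) ⊣ GammaCat.mapFunctor k d (zFun k p) :=
  GammaCat.mapAdjunction k d (VA.tzAdjunction k p)

variable {k p d}

/-- On the summand `V ⊗ x^j`, the multiplication `A ⊗ (A ⊗ V) → A ⊗ V` is multiplication by `x^j`,
of degree `2 j`. -/
theorem map_zProj_comp_counit_mem (X : VA k p) (j : Fin p) :
    (tFun k p).map (zProj X j) ≫ (VA.tzAdjunction k p).counit.app X ∈
      GradedLinear.homDeg (k := k) ((tFun k p).obj ((zFun k p).obj X)) X (2 * (j : ℤ)) := by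
  intro i y hy
  induction hy using Submodule.span_induction with
  | zero => rw [map_zero]; exact Submodule.zero_mem _
  | add a b _ _ ha hb => rw [map_add]; exact Submodule.add_mem _ ha hb
  | smul c a _ ha => rw [LinearMap.map_smul_of_tower]; exact Submodule.smul_mem _ _ ha
  | mem y hy =>
    obtain ⟨l, (v : X.mod), rfl, rfl⟩ := hy
    have h : LinearMap.liftBaseChange (TruncPoly k p) (LinearMap.id : X.mod →ₗ[k] X.mod)
        (LinearMap.baseChange (TruncPoly k p) (X.proj j) ((xA k p ^ l) ⊗ₜ v)) =
          xA k p ^ l • X.proj j v := by simp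
    have h' := VA.pow_smul_mem X l (X.proj_mem j v)
    rw [← h] at h'
    exact h'

/-- On the summands `A ⊗ (V ⊗ x^{s 1}), …, A ⊗ (V ⊗ x^{s d})` that `e_γ` selects, the multiplications
have total degree `∑ j, γ_j * 2 j`. -/
theorem map_zIdem_comp_counit_mem (X : GammaCat k d (VA k p))
    (γ : GammaCat.MultiIndex (Fin p) d) :
    (GammaCat.mapFunctor k d (tFun k p)).map (zIdem X γ) ≫ (gammaAdj k p d).counit.app X ∈
      GradedLinear.homDeg (k := k) _ X (zWeight γ) := by
  change ((PiTensorProduct.map₂ fun _ => compBilin k _ _ _).flip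
        (PiTensorProduct.tprod k fun _ => (VA.tzAdjunction k p).counit.app X.obj) ∘ₗ
      PiTensorProduct.map fun _ => (tFun k p).mapLinearMap k)
    (GammaCat.weightTensor (zProj X.obj) γ.1) ∈ tensorDeg d _ _
  refine GammaCat.map_weightTensor_mem _ _ _ _ fun s hs => ?_
  rw [LinearMap.comp_apply, LinearMap.flip_apply, PiTensorProduct.map_tprod,
    PiTensorProduct.map₂_tprod_tprod]
  exact Submodule.subset_span ⟨fun i => 2 * (s i : ℤ), _,
    fun i => map_zProj_comp_counit_mem X.obj (s i), hs fun j => 2 * (j : ℤ), rfl⟩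

/-- The unit `v ↦ 1 ⊗ v` takes values in `V ⊗ x^0`. -/
theorem unit_comp_zProj (V : FGModuleCat.{u} k) (j : Fin p) (hj : (j : ℕ) ≠ 0) :
    (VA.tzAdjunction k p).unit.app V ≫ zProj ((tFun k p).obj V) j = 0 := by
  apply FGModuleCat.hom_ext
  refine LinearMap.ext fun v => ?_
  exact VA.proj_ne _ j (by lia) (VA.one_tmul_mem ((tFun k p).obj V) v)

/-- A nonzero weight involves some `x^j` with `j ≠ 0`, which does not occur in the image of the
unit. -/
theorem unit_comp_zIdem (V : GammaCat k d (FGModuleCat.{u} k))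
    (γ : GammaCat.MultiIndex (Fin p) d) (hγ : zWeight γ ≠ 0) :
    (gammaAdj k p d).unit.app V ≫ zIdem ((GammaCat.mapFunctor k d (tFun k p)).obj V) γ = 0 := by
  apply Subtype.ext
  change PiTensorProduct.map₂ (fun _ => compBilin k _ _ _)
      (PiTensorProduct.tprod k fun _ => (VA.tzAdjunction k p).unit.app V.obj)
      (GammaCat.weightTensor (zProj ((tFun k p).obj V.obj)) γ.1) = 0
  rw [← Submodule.mem_bot k]
  refine GammaCat.map_weightTensor_mem _ _ _ _ fun s hs => ?_
  rw [PiTensorProduct.map₂_tprod_tprod, Submodule.mem_bot]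
  obtain ⟨i, -, hi⟩ := Finset.exists_ne_zero_of_sum_ne_zero
    ((hs fun j => 2 * (j : ℤ)).trans_ne hγ)
  exact (PiTensorProduct.tprod k).map_coord_zero i
    (unit_comp_zProj V.obj (s i) fun h0 => hi (by simp [h0]))

/-- The map `F(η_V)` has degree `0`: it only meets the parts `F(V ⊗ A)_γ` of weight `0`, whose degree
is not shifted. -/
theorem map_unit_mem (F : PolyFun k d) (V : GammaCat k d (FGModuleCat.{u} k)) :
    (F.obj.map ((gammaAdj k p d).unit.app V)).1 ∈
      GrVect.linDeg (F.obj.obj V) (zStarObj F ((GammaCat.mapFunctor k d (tFun k p)).obj V)) 0 := by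
  intro i x hx
  rw [add_zero]
  set X := (GammaCat.mapFunctor k d (tFun k p)).obj V
  set y := (F.obj.map ((gammaAdj k p d).unit.app V)).1 x
  have h := LinearMap.congr_fun (zAct_sum F X) y
  rw [LinearMap.id_apply, LinearMap.sum_apply] at h
  rw [← h]
  refine Submodule.sum_mem _ fun γ _ => Submodule.mem_iSup_of_mem γ ?_
  by_cases hγ : zWeight γ = 0
  · refine Submodule.mem_map_of_mem ?_
    rw [hγ, sub_zero]
    have := PolyFun.map_deg F ((gammaAdj k p d).unit.app V) i x hx
    rwa [add_zero] at this
  · have h0 := F.obj.map_comp ((gammaAdj k p d).unit.app V) (zIdem X γ)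
    rw [unit_comp_zIdem V γ hγ, (F.property.linear _ _).map_zero] at h0
    have h1 : (0 : _) = zAct F X γ y := LinearMap.congr_fun (congrArg Subtype.val h0) x
    rw [← h1]
    exact Submodule.zero_mem _

/-- The map `G(ε_X)` has degree `0`: on the part cut out by `e_γ` it raises the degree of `G` by the
weight of `γ`, which is the shift built into `z^*`. -/
theorem map_counit_mem (G : AffPolyFun k p d) (X : GammaCat k d (VA k p)) :
    (G.obj.map ((gammaAdj k p d).counit.app X)).1 ∈
      GrVect.linDeg (zStarObj ((tStar k p d).obj G) X) (G.obj.obj X) 0 := by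
  intro l x hx
  refine GrVect.map_mem_of_mem_shiftDeg _ _ (fun γ y hy => ?_) hx
  have h := G.property.map_mem (map_zIdem_comp_counit_mem X γ) _ y hy
  rw [G.obj.map_comp, sub_add_cancel] at h
  rw [add_zero]
  exact h

/-- The functor `z^*` preserves degrees of morphisms: by naturality these commute with the `e_γ`, so
both sides are shifted alike. -/
theorem zStar_map_app_mem {F F' : PolyFun k d} (φ : F ⟶ F') {n : ℤ} (hφ : φ ∈ natDeg F F' n) :
    (zStar k p d).map φ ∈ natDeg _ _ n := by
  intro X l x hx
  refine GrVect.map_mem_of_mem_shiftDeg (φ.hom.app _).1 _ (fun γ y hy => ?_) hx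
  have h := LinearMap.congr_fun (congrArg Subtype.val (φ.hom.naturality (zIdem X γ))) y
  refine Submodule.mem_iSup_of_mem γ ⟨(φ.hom.app _).1 y, ?_, h.symm⟩
  have := hφ _ _ y hy
  rwa [sub_add_eq_add_sub] at this

/-! ### The adjunction between `z^*` and `t^*` -/

/-- The component `F(η_V)` of the unit `F ⟶ t^* z^* F`. -/
def starUnitApp (p : ℕ) (F : PolyFun k d) (V : GammaCat k d (FGModuleCat.{u} k)) :
    F.obj.obj V ⟶ zStarObj F ((GammaCat.mapFunctor k d (tFun k p)).obj V) :=
  ⟨(F.obj.map ((gammaAdj k p d).unit.app V)).1, Submodule.mem_iSup_of_mem 0 (map_unit_mem F V)⟩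

theorem starUnitApp_val (p : ℕ) (F : PolyFun k d) (V : GammaCat k d (FGModuleCat.{u} k)) :
    (starUnitApp p F V).1 = (F.obj.map ((gammaAdj k p d).unit.app V)).1 := by
  unfold starUnitApp
  rfl

theorem starUnitApp_naturality (F : PolyFun k d) {V W : GammaCat k d (FGModuleCat.{u} k)}
    (f : V ⟶ W) : F.obj.map f ≫ starUnitApp p F W =
      starUnitApp p F V ≫ zStarMap F ((GammaCat.mapFunctor k d (tFun k p)).map f) := by
  apply GrVect.hom_ext
  rw [GrVect.comp_val, GrVect.comp_val, zStarMap_val, starUnitApp_val, starUnitApp_val]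
  have h := congrArg F.obj.map ((gammaAdj k p d).unit_naturality f)
  rw [F.obj.map_comp, F.obj.map_comp] at h
  exact (congrArg Subtype.val h).symm

/-- The component `G(ε_X)` of the counit `z^* t^* G ⟶ G`. -/
def starCounitApp (G : AffPolyFun k p d) (X : GammaCat k d (VA k p)) :
    zStarObj ((tStar k p d).obj G) X ⟶ G.obj.obj X :=
  ⟨(G.obj.map ((gammaAdj k p d).counit.app X)).1, Submodule.mem_iSup_of_mem 0 (map_counit_mem G X)⟩

theorem starCounitApp_val (G : AffPolyFun k p d) (X : GammaCat k d (VA k p)) :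
    (starCounitApp G X).1 = (G.obj.map ((gammaAdj k p d).counit.app X)).1 := by
  unfold starCounitApp
  rfl

theorem starCounitApp_naturality (G : AffPolyFun k p d) {X Y : GammaCat k d (VA k p)}
    (f : X ⟶ Y) : zStarMap ((tStar k p d).obj G) f ≫ starCounitApp G Y =
      starCounitApp G X ≫ G.obj.map f := by
  apply GrVect.hom_ext
  rw [GrVect.comp_val, GrVect.comp_val, zStarMap_val, starCounitApp_val, starCounitApp_val]
  have h := congrArg G.obj.map ((gammaAdj k p d).counit_naturality f)
  rw [G.obj.map_comp, G.obj.map_comp] at h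
  exact congrArg Subtype.val h

/-- The unit `F ⟶ t^* z^* F`, given by `F(η)` for the unit `η` of `Γ^d t ⊣ Γ^d z`. -/
def starUnit (p : ℕ) (F : PolyFun k d) : F ⟶ (tStar k p d).obj ((zStar k p d).obj F) :=
  ObjectProperty.homMk
    { app := starUnitApp p F
      naturality _ _ f := starUnitApp_naturality F f }

/-- The counit `z^* t^* G ⟶ G`, given by `G(ε)` for the counit `ε` of `Γ^d t ⊣ Γ^d z`. -/
def starCounit (G : AffPolyFun k p d) : (zStar k p d).obj ((tStar k p d).obj G) ⟶ G :=
  ObjectProperty.homMk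
    { app := starCounitApp G
      naturality _ _ f := starCounitApp_naturality G f }

theorem starUnitApp_comp {F F' : PolyFun k d} (φ : F ⟶ F')
    (V : GammaCat k d (FGModuleCat.{u} k)) :
    φ.hom.app V ≫ starUnitApp p F' V =
      starUnitApp p F V ≫ zStarApp φ ((GammaCat.mapFunctor k d (tFun k p)).obj V) := by
  apply GrVect.hom_ext
  rw [GrVect.comp_val, GrVect.comp_val, zStarApp_val, starUnitApp_val, starUnitApp_val]
  exact (congrArg Subtype.val (φ.hom.naturality ((gammaAdj k p d).unit.app V))).symm

theorem starCounitApp_comp {G G' : AffPolyFun k p d} (φ : G ⟶ G') (X : GammaCat k d (VA k p)) :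
    zStarApp ((tStar k p d).map φ) X ≫ starCounitApp G' X =
      starCounitApp G X ≫ φ.hom.app X := by
  apply GrVect.hom_ext
  rw [GrVect.comp_val, GrVect.comp_val, zStarApp_val, starCounitApp_val, starCounitApp_val]
  exact (congrArg Subtype.val (φ.hom.naturality ((gammaAdj k p d).counit.app X))).symm

/-- The left triangle identity of `z^* ⊣ t^*`, from the right one of `Γ^d t ⊣ Γ^d z`. -/
theorem zStarApp_starUnit_comp_starCounitApp (F : PolyFun k d) (X : GammaCat k d (VA k p)) :
    zStarApp (starUnit p F) X ≫ starCounitApp ((zStar k p d).obj F) X = 𝟙 (zStarObj F X) := by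
  apply GrVect.hom_ext
  rw [GrVect.comp_val, GrVect.id_val, zStarApp_val, starCounitApp_val]
  change (zStarMap F _).1 ∘ₗ (starUnitApp p F _).1 = _
  rw [zStarMap_val, starUnitApp_val]
  have h := congrArg F.obj.map ((gammaAdj k p d).right_triangle_components X)
  rw [F.obj.map_comp, F.obj.map_id] at h
  exact congrArg Subtype.val h

/-- The right triangle identity of `z^* ⊣ t^*`, from the left one of `Γ^d t ⊣ Γ^d z`. -/
theorem starUnitApp_comp_map_starCounitApp (G : AffPolyFun k p d)
    (V : GammaCat k d (FGModuleCat.{u} k)) :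
    starUnitApp p ((tStar k p d).obj G) V ≫
      starCounitApp G ((GammaCat.mapFunctor k d (tFun k p)).obj V) =
        𝟙 (((tStar k p d).obj G).obj.obj V) := by
  apply GrVect.hom_ext
  rw [GrVect.comp_val, GrVect.id_val, starUnitApp_val, starCounitApp_val]
  have h := congrArg G.obj.map ((gammaAdj k p d).left_triangle_components V)
  rw [G.obj.map_comp, G.obj.map_id] at h
  exact congrArg Subtype.val h

variable (k p d) in
/-- Precomposition reverses the roles of the adjoints, so `Γ^d t ⊣ Γ^d z` gives `z^* ⊣ t^*`. -/
def starAdjunction : zStar k p d ⊣ tStar k p d where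
  unit :=
    { app := starUnit p
      naturality F F' φ := by
        apply ObjectProperty.hom_ext
        apply NatTrans.ext
        exact funext (starUnitApp_comp φ) }
  counit :=
    { app := starCounit
      naturality G G' φ := by
        apply ObjectProperty.hom_ext
        apply NatTrans.ext
        exact funext (starCounitApp_comp φ) }
  left_triangle_components F := by
    apply ObjectProperty.hom_ext
    apply NatTrans.ext
    exact funext (zStarApp_starUnit_comp_starCounitApp F)
  right_triangle_components G := by
    apply ObjectProperty.hom_ext
    apply NatTrans.ext
    exact funext (starUnitApp_comp_map_starCounitApp G)

theorem starUnit_mem (F : PolyFun k d) : starUnit p F ∈ natDeg _ _ 0 := fun V => map_unit_mem F V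

theorem starCounit_mem (G : AffPolyFun k p d) : starCounit G ∈ natDeg _ _ 0 :=
  fun X => map_counit_mem G X

theorem natDeg_comp {C : Type w} [Category.{v} C] [Preadditive C] [Linear k C] [GradedLinear k C]
    {F G H : GrFun k C} {m n : ℤ} {φ : F ⟶ G} {ψ : G ⟶ H} (hφ : φ ∈ natDeg F G m)
    (hψ : ψ ∈ natDeg G H n) : φ ≫ ψ ∈ natDeg F H (m + n) :=
  fun X => GradedLinear.comp_mem (hφ X) (hψ X)

theorem starAdjunction_homEquiv_mem {F : PolyFun k d} {G : AffPolyFun k p d} {n : ℤ}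
    {φ : (zStar k p d).obj F ⟶ G} (hφ : φ ∈ natDeg _ _ n) :
    (starAdjunction k p d).homEquiv F G φ ∈ natDeg _ _ n := by
  have h : (tStar k p d).map φ ∈ natDeg _ _ n :=
    fun V => hφ ((GammaCat.mapFunctor k d (tFun k p)).obj V)
  have := natDeg_comp (starUnit_mem (p := p) F) h
  rw [zero_add] at this
  rw [Adjunction.homEquiv_unit]
  exact this

theorem starAdjunction_homEquiv_symm_mem {F : PolyFun k d} {G : AffPolyFun k p d} {n : ℤ}
    {ψ : F ⟶ (tStar k p d).obj G} (hψ : ψ ∈ natDeg _ _ n) :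
    ((starAdjunction k p d).homEquiv F G).symm ψ ∈ natDeg _ _ n := by
  have := natDeg_comp (zStar_map_app_mem ψ hψ) (starCounit_mem G)
  rw [add_zero] at this
  rw [Adjunction.homEquiv_counit]
  exact this

theorem starAdjunction_homEquiv_isLinearMap (F : PolyFun k d) (G : AffPolyFun k p d) :
    IsLinearMap k ((starAdjunction k p d).homEquiv F G) where
  map_add φ ψ := by
    simp only [Adjunction.homEquiv_unit]
    exact Preadditive.comp_add _ _ _ _ ((tStar k p d).map φ) ((tStar k p d).map ψ)
  map_smul c φ := by
    simp only [Adjunction.homEquiv_unit]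
    exact Linear.comp_smul _ _ _ _ c ((tStar k p d).map φ)

/-! ### Representable functors -/

/-- A bijective linear map of degree `0` is an isomorphism of graded spaces: its inverse again has
degree `0`, because it commutes with the projections onto the homogeneous parts. -/
def GrVect.isoOfLinearEquiv {X Y : GrVect k} (e : X.carrier ≃ₗ[k] Y.carrier)
    (he : e.toLinearMap ∈ linDeg X Y 0) : X ≅ Y where
  hom := ⟨e.toLinearMap, Submodule.mem_iSup_of_mem 0 he⟩
  inv := ⟨e.symm.toLinearMap, Submodule.mem_iSup_of_mem 0 fun i y hy => by
    have h := gproj_comm X.isInternal Y.isInternal e.toLinearMap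
      (fun n x hx => by simpa using he n x hx) i (e.symm y)
    rw [LinearEquiv.coe_coe, LinearEquiv.apply_symm_apply, gproj_same _ hy] at h
    rw [LinearEquiv.coe_coe, add_zero, LinearEquiv.symm_apply_eq _ |>.2 h]
    exact gproj_mem _ _ _⟩
  hom_inv_id := GrVect.hom_ext e.symm_comp
  inv_hom_id := GrVect.hom_ext e.comp_symm

/-- The linear bijection `Hom(U, z X) ≅ Hom(t U, X)` of the adjunction `Γ^d t ⊣ Γ^d z`. -/
def gammaHomEquiv (U : GammaCat k d (FGModuleCat.{u} k)) (X : GammaCat k d (VA k p)) :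
    (U ⟶ (GammaCat.mapFunctor k d (zFun k p)).obj X) ≃ₗ[k]
      ((GammaCat.mapFunctor k d (tFun k p)).obj U ⟶ X) :=
  { ((gammaAdj k p d).homEquiv U X).symm with
    map_add' f g := by
      change ((gammaAdj k p d).homEquiv U X).symm (f + g) =
        ((gammaAdj k p d).homEquiv U X).symm f + ((gammaAdj k p d).homEquiv U X).symm g
      simp only [Adjunction.homEquiv_counit]
      rw [(GammaCat.mapFunctor_linear _ _ _).map_add, Preadditive.add_comp]
    map_smul' c f := by
      change ((gammaAdj k p d).homEquiv U X).symm (c • f) =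
        c • ((gammaAdj k p d).homEquiv U X).symm f
      simp only [Adjunction.homEquiv_counit]
      rw [(GammaCat.mapFunctor_linear _ _ _).map_smul, Linear.smul_comp] }

theorem gammaHomEquiv_apply {U : GammaCat k d (FGModuleCat.{u} k)} {X : GammaCat k d (VA k p)}
    (f : U ⟶ (GammaCat.mapFunctor k d (zFun k p)).obj X) :
    gammaHomEquiv U X f =
      (GammaCat.mapFunctor k d (tFun k p)).map f ≫ (gammaAdj k p d).counit.app X :=
  (gammaAdj k p d).homEquiv_counit U X f

theorem gammaHomEquiv_comp_zIdem_mem {U : GammaCat k d (FGModuleCat.{u} k)}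
    {X : GammaCat k d (VA k p)} (γ : GammaCat.MultiIndex (Fin p) d) {l : ℤ}
    {y : U ⟶ (GammaCat.mapFunctor k d (zFun k p)).obj X}
    (hy : y ∈ GradedLinear.homDeg (k := k) _ _ (l - zWeight γ)) :
    gammaHomEquiv U X (y ≫ zIdem X γ) ∈ GradedLinear.homDeg (k := k) _ _ l := by
  have h := GradedLinear.comp_mem
    ((GammaCat.mapFunctor_isGraded (tFun k p) (tFun_isGraded k p)).map_mem hy)
    (map_zIdem_comp_counit_mem X γ)
  rw [sub_add_cancel, ← Category.assoc, ← Functor.map_comp] at h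
  rw [gammaHomEquiv_apply]
  exact h

/-- The representable functor `Γ^{d,U}`, which is contravariant in `U`. -/
abbrev gammaRep (U : (GammaCat k d (FGModuleCat.{u} k))ᵒᵖ) : PolyFun k d :=
  (representable k (GammaCat k d (FGModuleCat.{u} k))).obj U

variable (p) in
/-- The representable functor `h^{U ⊗ A}`, which is contravariant in `U`. -/
abbrev affRep (U : (GammaCat k d (FGModuleCat.{u} k))ᵒᵖ) : AffPolyFun k p d :=
  (representable k (GammaCat k d (VA k p))).obj ((GammaCat.mapFunctor k d (tFun k p)).op.obj U)

/-- The bijection `z^*(Γ^{d,U})(X) ≅ h^{U ⊗ A}(X)`. -/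
def zStarRepresentableEquiv (U : (GammaCat k d (FGModuleCat.{u} k))ᵒᵖ)
    (X : GammaCat k d (VA k p)) :
    (zStarObj (gammaRep U) X).carrier ≃ₗ[k] ((affRep p U).obj.obj X).carrier :=
  gammaHomEquiv U.unop X

/-- The idempotent `e_γ` acts on `Γ^{d,U}(z X)` by composition. -/
theorem zStarRepresentableEquiv_zAct {U : (GammaCat k d (FGModuleCat.{u} k))ᵒᵖ}
    {X : GammaCat k d (VA k p)} (γ : GammaCat.MultiIndex (Fin p) d)
    (y : (zStarObj (gammaRep U) X).carrier) :
    zStarRepresentableEquiv U X (zAct (gammaRep U) X γ y) =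
      gammaHomEquiv U.unop X (CategoryStruct.comp (X := U.unop) y (zIdem X γ)) := rfl

theorem zStarRepresentableEquiv_mem (U : (GammaCat k d (FGModuleCat.{u} k))ᵒᵖ)
    (X : GammaCat k d (VA k p)) :
    (zStarRepresentableEquiv U X).toLinearMap ∈
      GrVect.linDeg (zStarObj (gammaRep U) X) ((affRep p U).obj.obj X) 0 := by
  intro l x hx
  refine GrVect.map_mem_of_mem_shiftDeg (zStarRepresentableEquiv U X).toLinearMap _
    (fun γ y hy => ?_) hx
  rw [add_zero]
  have h := gammaHomEquiv_comp_zIdem_mem γ hy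
  rw [← zStarRepresentableEquiv_zAct] at h
  exact h

/-- The isomorphism of graded spaces `z^*(Γ^{d,U})(X) ≅ h^{U ⊗ A}(X)`. -/
def zStarRepresentableIsoApp (U : (GammaCat k d (FGModuleCat.{u} k))ᵒᵖ)
    (X : GammaCat k d (VA k p)) :
    zStarObj (gammaRep U) X ≅ (affRep p U).obj.obj X :=
  GrVect.isoOfLinearEquiv (zStarRepresentableEquiv U X) (zStarRepresentableEquiv_mem U X)

theorem zStarRepresentableIsoApp_hom_val (U : (GammaCat k d (FGModuleCat.{u} k))ᵒᵖ)
    (X : GammaCat k d (VA k p)) :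
    (zStarRepresentableIsoApp U X).hom.1 = (zStarRepresentableEquiv U X).toLinearMap := rfl

theorem zStarRepresentableIsoApp_naturality (U : (GammaCat k d (FGModuleCat.{u} k))ᵒᵖ)
    {X Y : GammaCat k d (VA k p)} (f : X ⟶ Y) :
    zStarMap (gammaRep U) f ≫ (zStarRepresentableIsoApp U Y).hom =
      (zStarRepresentableIsoApp U X).hom ≫ (affRep p U).obj.map f := by
  apply GrVect.hom_ext
  rw [GrVect.comp_val, GrVect.comp_val, zStarMap_val, zStarRepresentableIsoApp_hom_val,
    zStarRepresentableIsoApp_hom_val]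
  refine LinearMap.ext fun x => ?_
  exact (gammaAdj k p d).homEquiv_naturality_right_symm x f

theorem zStarRepresentableIsoApp_naturality_left {U U' : (GammaCat k d (FGModuleCat.{u} k))ᵒᵖ}
    (f : U ⟶ U') (X : GammaCat k d (VA k p)) :
    zStarApp ((representable k (GammaCat k d (FGModuleCat.{u} k))).map f) X ≫
        (zStarRepresentableIsoApp U' X).hom =
      (zStarRepresentableIsoApp U X).hom ≫
        ((representable k (GammaCat k d (VA k p))).map
          ((GammaCat.mapFunctor k d (tFun k p)).op.map f)).hom.app X := by
  apply GrVect.hom_ext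
  rw [GrVect.comp_val, GrVect.comp_val, zStarApp_val, zStarRepresentableIsoApp_hom_val,
    zStarRepresentableIsoApp_hom_val]
  refine LinearMap.ext fun x => ?_
  exact (gammaAdj k p d).homEquiv_naturality_left_symm f.unop x

/-- The isomorphism `z^*(Γ^{d,U}) ≅ h^{U ⊗ A}`. -/
def zStarGammaRepIso (U : (GammaCat k d (FGModuleCat.{u} k))ᵒᵖ) :
    (zStar k p d).obj (gammaRep U) ≅ affRep p U :=
  ObjectProperty.isoMk _ (NatIso.ofComponents
    (zStarRepresentableIsoApp U) (zStarRepresentableIsoApp_naturality U))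

theorem zStarGammaRepIso_naturality {U U' : (GammaCat k d (FGModuleCat.{u} k))ᵒᵖ} (f : U ⟶ U') :
    (representable k (GammaCat k d (FGModuleCat.{u} k)) ⋙ zStar k p d).map f ≫
        (zStarGammaRepIso U').hom =
      (zStarGammaRepIso U).hom ≫ ((GammaCat.mapFunctor k d (tFun k p)).op ⋙
        representable k (GammaCat k d (VA k p))).map f := by
  apply ObjectProperty.hom_ext
  apply NatTrans.ext
  funext X
  exact zStarRepresentableIsoApp_naturality_left f X

variable (k p d) in
/-- The isomorphisms `z^*(Γ^{d,U}) ≅ h^{U ⊗ A}`, natural in `U`. -/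
def zStarRepresentableIso :
    representable k (GammaCat k d (FGModuleCat.{u} k)) ⋙ zStar k p d ≅
      (GammaCat.mapFunctor k d (tFun k p)).op ⋙ representable k (GammaCat k d (VA k p)) :=
  NatIso.ofComponents zStarGammaRepIso zStarGammaRepIso_naturality

theorem zStarRepresentableIso_hom_app_mem (U : (GammaCat k d (FGModuleCat.{u} k))ᵒᵖ) :
    (zStarRepresentableIso k p d).hom.app U ∈ natDeg _ _ 0 :=
  fun X => zStarRepresentableEquiv_mem U X

end

end AffineSPF

end

theorem proposition2p3 (k : Type*) [Field k] (p : ℕ) [Fact p.Prime] [CharP k p] (d : ℕ) :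
    (∃ α : AffineSPF.representable k (AffineSPF.GammaCat k d (FGModuleCat k)) ⋙
          AffineSPF.zStar k p d ≅
        (AffineSPF.GammaCat.mapFunctor k d (AffineSPF.tFun k p)).op ⋙
          AffineSPF.representable k (AffineSPF.GammaCat k d (AffineSPF.VA k p)),
      ∀ U, α.hom.app U ∈ AffineSPF.natDeg _ _ 0) ∧
    (∃ adj : AffineSPF.zStar k p d ⊣ AffineSPF.tStar k p d,
      ∀ (F : AffineSPF.PolyFun k d) (G : AffineSPF.AffPolyFun k p d),
        IsLinearMap k (adj.homEquiv F G) ∧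
        ∀ (n : ℤ) (φ : (AffineSPF.zStar k p d).obj F ⟶ G),
          φ ∈ AffineSPF.natDeg _ _ n ↔ adj.homEquiv F G φ ∈ AffineSPF.natDeg _ _ n) := by
  refine ⟨⟨AffineSPF.zStarRepresentableIso k p d,
    AffineSPF.zStarRepresentableIso_hom_app_mem⟩,
    AffineSPF.starAdjunction k p d, fun F G =>
      ⟨AffineSPF.starAdjunction_homEquiv_isLinearMap F G, fun n φ =>
        ⟨AffineSPF.starAdjunction_homEquiv_mem, fun h => ?_⟩⟩⟩
  have := AffineSPF.starAdjunction_homEquiv_symm_mem h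
  rwa [Equiv.symm_apply_apply] at this
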